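/- **Setting.** Let $m>0$, and let $\alpha_1,\alpha_2,\alpha_3,\beta$ be the $4\times4$ Dirac matrices $\alpha_j=\begin{pmatrix}0&\sigma_j\\ \sigma_j&0\end{pmatrix}$ ($\sigma_j$ the Pauli matrices), $\beta=\begin{pmatrix}I_2&0\\0&-I_2\end{pmatrix}$. Let $H=-i\alpha\cdot\nabla+m\beta$ be the free Dirac operator in $L^2(\mathbb R^3)^4$ with domain $H^1(\mathbb R^3)^4$. Let $\Omega\subset\mathbb R^3$ be a bounded open set with $C^2$ boundary $\Sigma=\partial\Omega$ and outward unit normal $\nu$, and for $\epsilon>0$ let $\Omega_\epsilon=\{x:d(x,\Sigma)<\epsilon\}$. Let $\eta>0$ be so small that for every $0<\epsilon\le\eta$ the map $(x_\Sigma,t)\mapsto x_\Sigma+t\,\nu(x_\Sigma)$ is a bijection from $\Sigma\times(-\epsilon,\epsilon)$ onto $\Omega_\epsilon$. Let $V\in L^\infty(\mathbb R)$ be real-valued with $\operatorname{supp}V\subset[-\eta,\eta]$, let $0<\epsilon\le\eta$, and put $$\mathbf V_\epsilon(x_\Sigma+t\nu(x_\Sigma))=\frac{\eta}{\epsilon}V\Big(\frac{\eta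 t}{\epsilon}\Big)\quad (x_\Sigma\in\Sigma,\ |t|<\epsilon),\qquad \mathbf V_\epsilon=0\ \text{ outside }\Omega_\epsilon,$$ $\mathbf u_\epsilon=|\mathbf V_\epsilon|^{1/2}$, $\mathbf v_\epsilon=\operatorname{sign}(\mathbf V_\epsilon)|\mathbf V_\epsilon|^{1/2}$. These three functions are in $L^\infty(\mathbb R^3)$, and are identified with the corresponding multiplication operators on $L^2(\mathbb R^3)^4$. Let $H^e_\epsilon=H+\mathbf V_\epsilon$ and $H^s_\epsilon=H+\beta\mathbf V_\epsilon$, with domain $H^1(\mathbb R^3)^4$. Let $a\in(\mathbb C\setminus\mathbb R)\cup(-m,m)$, choose $\sqrt{m^2-a^2}$ with positive real part, and let $$\phi^a(x)=\frac{e^{-\sqrt{m^2-a^2}\,|x|}}{4\pi|x|}\Big(a+m\beta+\big(1+\sqrt{m^2-a^2}\,|x|\big)\,i\,\alpha\cdot\frac{x}{|x|^2}\Big)\qquad(x\ne0).$$ For $G\in L^2(\mathbb R^3)^4$ put $\Phi^aG(x)=\int_{\mathbb R^3}\phi^a(x-y)G(y)\,dy$; the integral converges absolutely for almost every $x$, and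 $\Phi^a$ is a bounded operator on $L^2(\mathbb R^3)^4$. Below, $\rho(\cdot)$ is the resolvent set, $\sigma_{pp}(\cdot)$ is the set of eigenvalues, and the multiplicity of an eigenvalue is the dimension of its eigenspace. **Electrostatic case.** 1. $a\in\rho(H^e_\epsilon)$ if and only if $-1\in\rho(\mathbf u_\epsilon\Phi^a\mathbf v_\epsilon)$. 2. $a\in\sigma_{pp}(H^e_\epsilon)$ if and only if $-1\in\sigma_{pp}(\mathbf u_\epsilon\Phi^a\mathbf v_\epsilon)$, and the multiplicity of $a$ as an eigenvalue of $H^e_\epsilon$ equals the multiplicity of $-1$ as an eigenvalue of $\mathbf u_\epsilon\Phi^a\mathbf v_\epsilon$. 3. If $a\in\rho(H^e_\epsilon)$, then $1+\mathbf u_\epsilon\Phi^a\mathbf v_\epsilon$ is invertible and $$(H^e_\epsilon-a)^{-1}=\Phi^a-\Phi^a\mathbf v_\epsilon\,(1+\mathbf u_\epsilon\Phi^a\mathbf v_\epsilon)^{-1}\,\mathbf u_\epsilon\Phi^a .$$ **Lorentz scalar case.** 1. $a\in\rho(H^s_\epsilon)$ if and only if $-1\in\rho(\beta\mathbf u_\epsilon\Phi^a\mathbf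 v_\epsilon)$. 2. $a\in\sigma_{pp}(H^s_\epsilon)$ if and only if $-1\in\sigma_{pp}(\beta\mathbf u_\epsilon\Phi^a\mathbf v_\epsilon)$, and the multiplicity of $a$ as an eigenvalue of $H^s_\epsilon$ equals the multiplicity of $-1$ as an eigenvalue of $\beta\mathbf u_\epsilon\Phi^a\mathbf v_\epsilon$. 3. If $a\in\rho(H^s_\epsilon)$, then $\beta+\mathbf u_\epsilon\Phi^a\mathbf v_\epsilon$ is invertible and $$(H^s_\epsilon-a)^{-1}=\Phi^a-\Phi^a\mathbf v_\epsilon\,(\beta+\mathbf u_\epsilon\Phi^a\mathbf v_\epsilon)^{-1}\,\mathbf u_\epsilon\Phi^a .$$ -/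

import Mathlib

noncomputable section

open MeasureTheory Set Filter Topology TemperedDistribution
open scoped SchwartzMap LineDeriv

namespace DiracShell

/-! ### Spaces -/

/-- The physical space `ℝ³`, with its Euclidean norm and Lebesgue measure. -/
abbrev Space : Type := EuclideanSpace ℝ (Fin 3)

/-- The values `ℂ⁴` of the wave functions. -/
abbrev Spinor : Type := EuclideanSpace ℂ (Fin 4)

/-- The Hilbert space `L²(ℝ³)⁴`. -/
abbrev L2 : Type := Lp Spinor 2 (volume : Measure Space)

/-! ### Unbounded operators: resolvent set, resolvent, eigenvalues -/

/-- `R` is a bounded inverse of `T - a`: it maps into the domain of `T`, and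
`(T - a) R y = y` for all `y`, `R (T - a) x = x` for all `x` in the domain. -/
def IsResolventAt (T : L2 →ₗ.[ℂ] L2) (a : ℂ) (R : L2 →L[ℂ] L2) : Prop :=
  (∀ y : L2, ∃ h : R y ∈ T.domain, T ⟨R y, h⟩ - a • R y = y) ∧
    ∀ x : T.domain, R (T x - a • (x : L2)) = x

/-- The resolvent set `ρ(T)` of an unbounded operator. -/
def resolventSetOf (T : L2 →ₗ.[ℂ] L2) : Set ℂ :=
  {a | ∃ R : L2 →L[ℂ] L2, IsResolventAt T a R}

open Classical in
/-- The resolvent `(T - a)⁻¹`, for `a ∈ ρ(T)` (and `0` outside `ρ(T)`). -/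
def resolventOf (T : L2 →ₗ.[ℂ] L2) (a : ℂ) : L2 →L[ℂ] L2 :=
  if h : ∃ R : L2 →L[ℂ] L2, IsResolventAt T a R then h.choose else 0

/-- The eigenspace `ker (T - a)` of an unbounded operator, a subspace of its domain. -/
def eigenspaceOf (T : L2 →ₗ.[ℂ] L2) (a : ℂ) : Submodule ℂ T.domain :=
  LinearMap.ker (T.toFun - a • T.domain.subtype)

/-- The pure point spectrum `σ_pp(T)`: the set of eigenvalues. -/
def pointSpectrumOf (T : L2 →ₗ.[ℂ] L2) : Set ℂ :=
  {a | ∃ x : T.domain, x ≠ 0 ∧ T x = a • (x : L2)}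

/-! ### Dirac matrices -/

/-- The matrices `αⱼ = (0 σⱼ; σⱼ 0)`, where `σ₁, σ₂, σ₃` are the Pauli matrices. -/
def alpha : Fin 3 → Matrix (Fin 4) (Fin 4) ℂ :=
  ![!![0, 0, 0, 1;
       0, 0, 1, 0;
       0, 1, 0, 0;
       1, 0, 0, 0],
    !![0, 0, 0, -Complex.I;
       0, 0, Complex.I, 0;
       0, -Complex.I, 0, 0;
       Complex.I, 0, 0, 0],
    !![0, 0, 1, 0;
       0, 0, 0, -1;
       1, 0, 0, 0;
       0, -1, 0, 0]]

/-- The matrix `β = (I₂ 0; 0 -I₂)`. -/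
def beta : Matrix (Fin 4) (Fin 4) ℂ :=
  !![1, 0, 0, 0;
     0, 1, 0, 0;
     0, 0, -1, 0;
     0, 0, 0, -1]

/-- The bounded operator `(A f)(x) = A (f x)` on `L²(ℝ³)⁴` given by a constant matrix `A`. -/
def matOp (A : Matrix (Fin 4) (Fin 4) ℂ) : L2 →L[ℂ] L2 :=
  (Matrix.toEuclideanCLM (n := Fin 4) (𝕜 := ℂ) A).compLpL 2 volume

/-! ### The free Dirac operator on `H¹(ℝ³)⁴` -/

/-- The Sobolev space `H¹(ℝ³)⁴` as a subspace of `L²(ℝ³)⁴`. -/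
def H1 : Submodule ℂ L2 where
  carrier := {f | MemSobolev 1 2 (f : 𝓢'(Space, Spinor))}
  zero_mem' := by
    change MemSobolev 1 2 (Lp.toTemperedDistributionCLM Spinor volume 2 0)
    rw [map_zero]
    exact memSobolev_fun_zero _ _ _ _
  add_mem' := by
    intro f g hf hg
    change MemSobolev 1 2 (Lp.toTemperedDistributionCLM Spinor volume 2 (f + g))
    rw [map_add]
    exact hf.add hg
  smul_mem' := by
    intro c f hf
    change MemSobolev 1 2 (Lp.toTemperedDistributionCLM Spinor volume 2 (c • f))
    rw [map_smul]
    exact hf.smul c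

/-- The `j`-th vector of the standard basis of `ℝ³`. -/
def basisVec (j : Fin 3) : Space := EuclideanSpace.single j 1

/-- The distributional derivatives of a function of class `H¹` are functions of class `L²`. -/
theorem exists_weakDeriv (j : Fin 3) (f : H1) :
    ∃ g : L2, (g : 𝓢'(Space, Spinor)) = ∂_{basisVec j} ((f : L2) : 𝓢'(Space, Spinor)) := by
  have h : MemSobolev 1 2 ((f : L2) : 𝓢'(Space, Spinor)) := f.2
  have h' := h.lineDerivOp (m := basisVec j)
  rw [sub_self] at h'
  obtain ⟨g, hg⟩ := memSobolev_zero_iff.1 h'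
  exact ⟨g, hg.symm⟩

theorem toTemperedDistribution_inj {f g : L2}
    (h : (f : 𝓢'(Space, Spinor)) = (g : 𝓢'(Space, Spinor))) : f = g :=
  LinearMap.ker_eq_bot.1
    (Lp.ker_toTemperedDistributionCLM_eq_bot (F := Spinor) (μ := (volume : Measure Space))
      (p := 2)) h

/-- The weak partial derivative `∂ⱼ : H¹(ℝ³)⁴ → L²(ℝ³)⁴`. -/
def weakDeriv (j : Fin 3) : H1 →ₗ[ℂ] L2 where
  toFun f := (exists_weakDeriv j f).choose
  map_add' f g := by
    apply toTemperedDistribution_inj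
    rw [(exists_weakDeriv j (f + g)).choose_spec,
      ← Lp.toTemperedDistributionCLM_apply, ← Lp.toTemperedDistributionCLM_apply,
      map_add, Submodule.coe_add, map_add, LineDeriv.lineDerivOp_add]
    simp only [Lp.toTemperedDistributionCLM_apply]
    rw [(exists_weakDeriv j f).choose_spec, (exists_weakDeriv j g).choose_spec]
  map_smul' c f := by
    apply toTemperedDistribution_inj
    rw [(exists_weakDeriv j (c • f)).choose_spec,
      ← Lp.toTemperedDistributionCLM_apply, ← Lp.toTemperedDistributionCLM_apply,
      RingHom.id_apply, map_smul, Submodule.coe_smul, map_smul, LineDeriv.lineDerivOp_smul]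
    simp only [Lp.toTemperedDistributionCLM_apply]
    rw [(exists_weakDeriv j f).choose_spec]

/-- The free Dirac operator `H = -i α·∇ + m β` with domain `H¹(ℝ³)⁴`. -/
def freeDirac (m : ℝ) : L2 →ₗ.[ℂ] L2 where
  domain := H1
  toFun := (∑ j : Fin 3, (-Complex.I) • (matOp (alpha j) : L2 →ₗ[ℂ] L2) ∘ₗ weakDeriv j) +
    (m : ℂ) • (matOp beta : L2 →ₗ[ℂ] L2) ∘ₗ H1.subtype

/-- The operator `H + B` with domain `H¹(ℝ³)⁴`, for a bounded operator `B`. -/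
def perturbedDirac (m : ℝ) (B : L2 →L[ℂ] L2) : L2 →ₗ.[ℂ] L2 where
  domain := (freeDirac m).domain
  toFun := (freeDirac m).toFun + (B : L2 →ₗ[ℂ] L2) ∘ₗ (freeDirac m).domain.subtype

/-! ### The operator `Φ^a` -/

/-- The fundamental solution of `H - a`,
`φ^a(x) = e^{-κ|x|} / (4π|x|) (a + m β + (1 + κ|x|) i α·x / |x|²)`, where `κ` is the principal
square root of `m² - a²`; it has positive real part for `a ∈ (ℂ \ ℝ) ∪ (-m, m)`. -/
def phi (m : ℝ) (a : ℂ) (x : Space) : Matrix (Fin 4) (Fin 4) ℂ :=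
  let κ : ℂ := Complex.sqrt ((m : ℂ) ^ 2 - a ^ 2)
  (Complex.exp (-κ * (‖x‖ : ℂ)) / (4 * (Real.pi : ℂ) * (‖x‖ : ℂ))) •
    (a • (1 : Matrix (Fin 4) (Fin 4) ℂ) + (m : ℂ) • beta +
      ((1 + κ * (‖x‖ : ℂ)) * Complex.I / (‖x‖ : ℂ) ^ 2) • ∑ j : Fin 3, (x j : ℂ) • alpha j)

/-- `T` is the operator of convolution with the matrix-valued kernel `k`:
`(T G)(x) = ∫ k(x - y) G(y) dy` for almost every `x`, the integral being absolutely convergent. -/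
def IsConvolutionOp (k : Space → Matrix (Fin 4) (Fin 4) ℂ) (T : L2 →L[ℂ] L2) : Prop :=
  ∀ G : L2, ∀ᵐ x : Space,
    Integrable (fun y : Space => Matrix.toEuclideanCLM (n := Fin 4) (𝕜 := ℂ) (k (x - y)) (G y)) ∧
    T G x = ∫ y : Space, Matrix.toEuclideanCLM (n := Fin 4) (𝕜 := ℂ) (k (x - y)) (G y)

open Classical in
/-- The bounded operator `Φ^a G = φ^a * G` on `L²(ℝ³)⁴`. -/
def Phi (m : ℝ) (a : ℂ) : L2 →L[ℂ] L2 :=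
  if h : ∃ T : L2 →L[ℂ] L2, IsConvolutionOp (phi m a) T then h.choose else 0

/-! ### The surface and its tubular neighbourhoods -/

/-- `Ω ⊆ ℝ³` is an open set with `C²` boundary: every boundary point `Q` is the centre of a ball in
which, with respect to an orthonormal coordinate system `L` with origin `Q`, the set `Ω` is
`{x₃ > ψ(x₁, x₂)}` and its boundary is `{x₃ = ψ(x₁, x₂)}`, where `ψ : ℝ² → ℝ` is of class `C²`. -/
def IsC2Domain (Ω : Set Space) : Prop :=
  IsOpen Ω ∧ ∀ Q ∈ frontier Ω, ∃ r > 0, ∃ ψ : EuclideanSpace ℝ (Fin 2) → ℝ, ContDiff ℝ 2 ψ ∧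
    ∃ L : Space ≃ₗᵢ[ℝ] Space, ∀ x ∈ Metric.ball Q r,
      (x ∈ Ω ↔ ψ (!₂[L (x - Q) 0, L (x - Q) 1]) < L (x - Q) 2) ∧
      (x ∈ frontier Ω ↔ L (x - Q) 2 = ψ (!₂[L (x - Q) 0, L (x - Q) 1]))

/-- `n` is an outward unit normal vector at the boundary point `Q` of `Ω`: it is a unit vector
orthogonal to all vectors tangent to the boundary, and it points out of `Ω`. -/
def IsOutwardUnitNormal (Ω : Set Space) (Q n : Space) : Prop :=
  ‖n‖ = 1 ∧ (∀ w ∈ tangentConeAt ℝ (frontier Ω) Q, inner ℝ n w = 0) ∧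
    ∀ᶠ t in 𝓝[>] (0 : ℝ), Q + t • n ∉ Ω

/-- The outward unit normal vector field `ν` (for `C²` domains it exists and is unique at every
point of the boundary; it has no meaning elsewhere). -/
def nu (Ω : Set Space) (Q : Space) : Space :=
  Classical.epsilon (IsOutwardUnitNormal Ω Q)

/-- The map `(x_Σ, t) ↦ x_Σ + t ν(x_Σ)`. -/
def tubularMap (Ω : Set Space) (p : Space × ℝ) : Space := p.1 + p.2 • nu Ω p.1

/-- `Ω_ε`, the set of points at distance less than `ε` from `Σ = ∂Ω`. -/
def layer (Ω : Set Space) (ε : ℝ) : Set Space := Metric.thickening ε (frontier Ω)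

/-- `η > 0` is so small that, for every `0 < ε ≤ η`, the map `(x_Σ, t) ↦ x_Σ + t ν(x_Σ)` is a
bijection from `Σ × (-ε, ε)` onto `Ω_ε`. -/
def IsTubularRadius (Ω : Set Space) (η : ℝ) : Prop :=
  0 < η ∧ ∀ ε : ℝ, 0 < ε → ε ≤ η →
    BijOn (tubularMap Ω) (frontier Ω ×ˢ Ioo (-ε) ε) (layer Ω ε)

/-! ### The potentials -/

/-- `V_ε(t) = (η/ε) V(η t/ε)`. -/
def scaledV (V : ℝ → ℝ) (η ε t : ℝ) : ℝ := η / ε * V (η * t / ε)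

open Classical in
/-- The potential `𝐕_ε`: equal to `V_ε(t)` at `x = x_Σ + t ν(x_Σ) ∈ Ω_ε` with
`(x_Σ, t) ∈ Σ × (-ε, ε)`, and to `0` outside `Ω_ε`. -/
def bigV (Ω : Set Space) (V : ℝ → ℝ) (η ε : ℝ) (x : Space) : ℝ :=
  if x ∈ layer Ω ε then
    scaledV V η ε (Function.invFunOn (tubularMap Ω) (frontier Ω ×ˢ Ioo (-ε) ε) x).2
  else 0

/-- `𝐮_ε = |𝐕_ε|^{1/2}`. -/
def bigU (Ω : Set Space) (V : ℝ → ℝ) (η ε : ℝ) (x : Space) : ℝ :=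
  Real.sqrt |bigV Ω V η ε x|

/-- `𝐯_ε = sign(𝐕_ε) |𝐕_ε|^{1/2}`. -/
def smallV (Ω : Set Space) (V : ℝ → ℝ) (η ε : ℝ) (x : Space) : ℝ :=
  Real.sign (bigV Ω V η ε x) * Real.sqrt |bigV Ω V η ε x|

open Classical in
/-- The bounded operator of multiplication by a function `w ∈ L^∞(ℝ³)` on `L²(ℝ³)⁴`
(and `0` if `w` is not in `L^∞(ℝ³)`). -/
def mulOp (w : Space → ℝ) : L2 →L[ℂ] L2 :=
  if h : MemLp w ⊤ (volume : Measure Space) then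
    (ContinuousLinearMap.lsmul ℂ ℂ (E := Spinor)).holderL volume ⊤ 2 2 (h.ofReal (K := ℂ)).toLp
  else 0

/-- The electrostatic coupling `H^e_ε = H + 𝐕_ε`. -/
def electricDirac (m : ℝ) (Ω : Set Space) (V : ℝ → ℝ) (η ε : ℝ) : L2 →ₗ.[ℂ] L2 :=
  perturbedDirac m (mulOp (bigV Ω V η ε))

/-- The Lorentz scalar coupling `H^s_ε = H + β 𝐕_ε`. -/
def scalarDirac (m : ℝ) (Ω : Set Space) (V : ℝ → ℝ) (η ε : ℝ) : L2 →ₗ.[ℂ] L2 :=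
  perturbedDirac m (matOp beta ∘L mulOp (bigV Ω V η ε))

/-- The Birman-Schwinger operator `𝐮_ε Φ^a 𝐯_ε` on `L²(ℝ³)⁴`. -/
def birmanSchwinger (m : ℝ) (Ω : Set Space) (V : ℝ → ℝ) (η ε : ℝ) (a : ℂ) : L2 →L[ℂ] L2 :=
  mulOp (bigU Ω V η ε) ∘L Phi m a ∘L mulOp (smallV Ω V η ε)

end DiracShell

end

noncomputable section

open MeasureTheory Set Filter Topology TemperedDistribution
open scoped SchwartzMap LineDeriv

namespace DiracShell

/-! ### The Birman–Schwinger principle -/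

/-! The statement is the Birman–Schwinger principle for a perturbation factored as `v u`. If `Φ = (H
- a)⁻¹` is bounded, the resolvent `R` of `H + v u` satisfies `R + Φ v u R = Φ = R + R v u Φ`. These
identities make `1 - u R v` an inverse of `1 + u Φ v`; conversely an inverse of `1 + u Φ v` gives `R
= Φ - Φ v (1 + u Φ v)⁻¹ u Φ`. On eigenvectors, `x ↦ u x` and `w ↦ -Φ v w` are mutually inverse
between `ker (H + v u - a)` and `ker (1 + u Φ v)`. The electrostatic case takes `u = 𝐮_ε`, `v =
𝐯_ε`. The scalar case takes `β 𝐮_ε` in place of `u`, since `β` commutes with scalar multiplications,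
and `β² = 1` converts `1 + β K` into `β + K`.

Two facts remain to be supplied.

The convolution `Φ^a` is the resolvent of `H` (`isResolventAt_Phi`). The Clifford relations give `(H
- a)(H + a) = κ² - Δ` with `κ² = m² - a²` outside `(-∞, 0]`, so the resolvent is `(H + a)(κ² -
Δ)⁻¹`, a Fourier multiplier that maps `L²` into `H¹`. In position space `(κ² - Δ)⁻¹` is convolution
with the Yukawa potential `e^{-κr}/(4πr)`. This is proved by replacing `r` with `√(r² + δ²)`: the
Helmholtz operator applied to the regularised potential is an approximate identity as `δ → 0`. The
kernel `φ^a` is `-iα·∇ + mβ + a` applied to the Yukawa potential; it is integrable, so Young's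
inequality makes `Φ^a` bounded, and it suffices to compare the two operators on Schwartz functions.

The potential `𝐕_ε` is essentially bounded (`memLp_bigV`). As `V` is controlled only almost
everywhere, the height coordinate `t` must be measurable and must pull null sets back to null sets.
Measurability holds because injective continuous images of Borel sets are Borel. Null sets are
preserved because, in a graph chart of class `C²`, the tubular map is differentiable, and
differentiable maps between spaces of equal dimension preserve null sets. -/

theorem perturbedDirac_apply (m : ℝ) (B : L2 →L[ℂ] L2) (x : L2) (hx : x ∈ H1) :
    (perturbedDirac m B) ⟨x, hx⟩ = (freeDirac m) ⟨x, hx⟩ + B x := rfl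

theorem IsResolventAt.unique {T : L2 →ₗ.[ℂ] L2} {a : ℂ} {R S : L2 →L[ℂ] L2}
    (hR : IsResolventAt T a R) (hS : IsResolventAt T a S) : R = S := by
  ext1 y
  obtain ⟨h, e⟩ := hS.1 y
  have := hR.2 ⟨S y, h⟩
  rwa [e] at this

theorem resolventOf_eq {T : L2 →ₗ.[ℂ] L2} {a : ℂ} {R : L2 →L[ℂ] L2}
    (hR : IsResolventAt T a R) : resolventOf T a = R := by
  have h : ∃ R : L2 →L[ℂ] L2, IsResolventAt T a R := ⟨R, hR⟩
  rw [resolventOf, dif_pos h]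
  exact h.choose_spec.unique hR

section BirmanSchwinger

variable {m : ℝ} {a : ℂ} {Φ u v : L2 →L[ℂ] L2}

/-- If `w` solves `w + u Φ v w = u Φ y`, then `x = Φ (y - v w)` has `u x = w`. Hence `(H - a) x + v
u x = (y - v w) + v w = y`. -/
theorem IsResolventAt.perturbed_of_isUnit (hΦ : IsResolventAt (freeDirac m) a Φ)
    (hK : IsUnit (1 + u ∘L Φ ∘L v)) :
    IsResolventAt (perturbedDirac m (v ∘L u)) a
      (Φ - Φ ∘L v ∘L Ring.inverse (1 + u ∘L Φ ∘L v) ∘L u ∘L Φ) := by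
  set S := Ring.inverse (1 + u ∘L Φ ∘L v) with hS
  have h1 (w : L2) : S w + u (Φ (v (S w))) = w :=
    DFunLike.congr_fun (Ring.mul_inverse_cancel _ hK) w
  have h2 (w : L2) : S (w + u (Φ (v w))) = w :=
    DFunLike.congr_fun (Ring.inverse_mul_cancel _ hK) w
  refine ⟨fun y => ?_, fun x => ?_⟩
  · set w := S (u (Φ y)) with hw
    have e : (Φ - Φ ∘L v ∘L S ∘L u ∘L Φ) y = Φ (y - v w) := by simp [hw]
    obtain ⟨hd, hz⟩ := hΦ.1 (y - v w)
    rw [e]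
    refine ⟨hd, ?_⟩
    rw [perturbedDirac_apply m _ _ hd, add_sub_right_comm, hz]
    have h3 : u (Φ (v w)) = u (Φ y) - w := by rw [eq_sub_iff_add_eq', hw, h1]
    simp [h3]
  · have h3 := hΦ.2 x
    have h4 : (perturbedDirac m (v ∘L u)) x - a • (x : L2)
        = ((freeDirac m) x - a • (x : L2)) + v (u x) := by
      rw [← add_sub_right_comm]; rfl
    have h5 : Φ ((perturbedDirac m (v ∘L u)) x - a • (x : L2)) = x + Φ (v (u x)) := by
      rw [h4, map_add, h3]
    simp only [_root_.sub_apply, ContinuousLinearMap.comp_apply, h5]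
    rw [map_add u, h2]
    simp

/-- The inverse is `1 - u R v`. The two forms of the second resolvent identity, placed between `u`
and `v`, verify it on the right and on the left. -/
theorem IsResolventAt.isUnit_of_perturbed (hΦ : IsResolventAt (freeDirac m) a Φ)
    {R : L2 →L[ℂ] L2} (hR : IsResolventAt (perturbedDirac m (v ∘L u)) a R) :
    IsUnit (1 + u ∘L Φ ∘L v) := by
  have h1 (y : L2) : R y + Φ (v (u (R y))) = Φ y := by
    obtain ⟨hd, e⟩ := hR.1 y
    rw [perturbedDirac_apply m _ _ hd, add_sub_right_comm] at e
    have := hΦ.2 ⟨R y, hd⟩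
    rw [eq_sub_of_add_eq e, map_sub] at this
    exact (sub_eq_iff_eq_add.1 this).symm
  have h2 (y : L2) : R y + R (v (u (Φ y))) = Φ y := by
    obtain ⟨hd, e⟩ := hΦ.1 y
    have := hR.2 ⟨Φ y, hd⟩
    rwa [perturbedDirac_apply m _ _ hd, add_sub_right_comm, e, map_add] at this
  refine ⟨⟨1 + u ∘L Φ ∘L v, 1 - u ∘L R ∘L v, ?_, ?_⟩, rfl⟩
  · ext1 y
    have := congrArg u (h1 (v y))
    simp only [map_add] at this
    simp only [mul_apply_eq_comp, _root_.add_apply,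
      _root_.sub_apply, one_apply_eq_self, ContinuousLinearMap.comp_apply,
      map_sub, ← this]
    abel
  · ext1 y
    have := congrArg u (h2 (v y))
    simp only [map_add] at this
    simp only [mul_apply_eq_comp, _root_.add_apply,
      _root_.sub_apply, one_apply_eq_self, ContinuousLinearMap.comp_apply,
      map_add]
    rw [sub_add_sub_comm, this, add_sub_cancel_right]

theorem IsResolventAt.mem_resolventSetOf_perturbed_iff (hΦ : IsResolventAt (freeDirac m) a Φ) :
    a ∈ resolventSetOf (perturbedDirac m (v ∘L u)) ↔ -1 ∈ resolventSet ℂ (u ∘L Φ ∘L v) := by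
  have h : algebraMap ℂ (L2 →L[ℂ] L2) (-1) - u ∘L Φ ∘L v = -(1 + u ∘L Φ ∘L v) := by
    rw [map_neg, map_one]; abel
  rw [spectrum.mem_resolventSet_iff, h, IsUnit.neg_iff]
  exact ⟨fun ⟨_, hR⟩ => hΦ.isUnit_of_perturbed hR, fun hK => ⟨_, hΦ.perturbed_of_isUnit hK⟩⟩

theorem mem_eigenspaceOf_perturbed_iff {x : (perturbedDirac m (v ∘L u)).domain} :
    x ∈ eigenspaceOf (perturbedDirac m (v ∘L u)) a ↔
      (freeDirac m) x - a • (x : L2) = - v (u x) := by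
  rw [eigenspaceOf, LinearMap.mem_ker]
  change (freeDirac m) x + v (u x) - a • (x : L2) = 0 ↔ _
  rw [add_sub_right_comm, add_eq_zero_iff_eq_neg]

/-- The eigenspaces of `H + v u` at `a` and of `u Φ v` at `-1` are isomorphic. -/
def IsResolventAt.eigenspaceEquiv (hΦ : IsResolventAt (freeDirac m) a Φ) :
    eigenspaceOf (perturbedDirac m (v ∘L u)) a ≃ₗ[ℂ]
      Module.End.eigenspace (u ∘L Φ ∘L v : L2 →ₗ[ℂ] L2) (-1) where
  -- Applying `Φ` to `(H - a) x = -v u x` gives `x = -Φ v u x`, which both proves the eigenvalue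
  -- equation for `u x` and recovers `x` from it.
  toFun x := ⟨u (x : L2), by
    have h := mem_eigenspaceOf_perturbed_iff.1 x.2
    have h' := hΦ.2 x.1
    rw [h, map_neg] at h'
    rw [Module.End.mem_eigenspace_iff]
    have h'' : u (Φ (v (u (x : L2)))) = - u (x : L2) := by
      rw [← neg_eq_iff_eq_neg, ← map_neg, h']
    simpa using h''⟩
  map_add' x y := Subtype.ext (map_add u (x : L2) (y : L2))
  map_smul' c x := Subtype.ext (map_smul u c (x : L2))
  invFun w := ⟨⟨Φ (-v w), (hΦ.1 (-v w)).1⟩, by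
    rw [mem_eigenspaceOf_perturbed_iff]
    have h := (Module.End.mem_eigenspace_iff.1 w.2)
    have h' : u (Φ (v w)) = - (w : L2) := by simpa using h
    refine (hΦ.1 (-v w)).2.trans ?_
    simp [h']⟩
  left_inv x := by
    have h := mem_eigenspaceOf_perturbed_iff.1 x.2
    have h' := hΦ.2 x.1
    rw [h] at h'
    ext1; ext1
    exact h'
  right_inv w := by
    have h := (Module.End.mem_eigenspace_iff.1 w.2)
    have h' : u (Φ (v w)) = - (w : L2) := by simpa using h
    ext1
    simp [h']

theorem mem_pointSpectrumOf_iff {T : L2 →ₗ.[ℂ] L2} :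
    a ∈ pointSpectrumOf T ↔ eigenspaceOf T a ≠ ⊥ := by
  rw [Submodule.ne_bot_iff]
  constructor
  · rintro ⟨x, hx, e⟩
    exact ⟨x, by rw [eigenspaceOf, LinearMap.mem_ker]; exact sub_eq_zero.2 e, hx⟩
  · rintro ⟨x, e, hx⟩
    rw [eigenspaceOf, LinearMap.mem_ker] at e
    exact ⟨x, hx, sub_eq_zero.1 e⟩

theorem IsResolventAt.mem_pointSpectrumOf_perturbed_iff (hΦ : IsResolventAt (freeDirac m) a Φ) :
    a ∈ pointSpectrumOf (perturbedDirac m (v ∘L u)) ↔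
      Module.End.HasEigenvalue (u ∘L Φ ∘L v : L2 →ₗ[ℂ] L2) (-1) := by
  rw [mem_pointSpectrumOf_iff, Module.End.hasEigenvalue_iff, ← Submodule.nontrivial_iff_ne_bot,
    ← Submodule.nontrivial_iff_ne_bot]
  exact hΦ.eigenspaceEquiv.toEquiv.nontrivial_congr

theorem IsResolventAt.resolventOf_perturbed (hΦ : IsResolventAt (freeDirac m) a Φ)
    (ha : a ∈ resolventSetOf (perturbedDirac m (v ∘L u))) :
    IsUnit (1 + u ∘L Φ ∘L v) ∧ resolventOf (perturbedDirac m (v ∘L u)) a =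
      Φ - Φ ∘L v ∘L Ring.inverse (1 + u ∘L Φ ∘L v) ∘L u ∘L Φ := by
  obtain ⟨R, hR⟩ := ha
  have hK := hΦ.isUnit_of_perturbed hR
  exact ⟨hK, resolventOf_eq (hΦ.perturbed_of_isUnit hK)⟩

end BirmanSchwinger

/-! ### Multiplication operators -/

theorem matOp_apply_ae (A : Matrix (Fin 4) (Fin 4) ℂ) (f : L2) :
    matOp A f =ᵐ[volume] fun x => Matrix.toEuclideanCLM (n := Fin 4) (𝕜 := ℂ) A (f x) :=
  ContinuousLinearMap.coeFn_compLpL _ _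

theorem mulOp_apply_ae {w : Space → ℝ} (hw : MemLp w ⊤ (volume : Measure Space)) (f : L2) :
    mulOp w f =ᵐ[volume] fun x => (w x : ℂ) • f x := by
  rw [mulOp, dif_pos hw]
  filter_upwards [ContinuousLinearMap.coeFn_holder (r := 2)
    (ContinuousLinearMap.lsmul ℂ ℂ (E := Spinor)) (hw.ofReal (K := ℂ)).toLp f,
    (hw.ofReal (K := ℂ)).coeFn_toLp] with x h1 h2
  rw [ContinuousLinearMap.holderL_apply_apply, h1, h2]
  rfl

theorem mulOp_mul {v w : Space → ℝ} (hv : MemLp v ⊤ (volume : Measure Space))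
    (hw : MemLp w ⊤ (volume : Measure Space))
    (hvw : MemLp (fun x => v x * w x) ⊤ (volume : Measure Space)) :
    mulOp (fun x => v x * w x) = mulOp v ∘L mulOp w := by
  ext1 f
  refine Lp.ext ?_
  filter_upwards [mulOp_apply_ae hvw f, mulOp_apply_ae hv (mulOp w f), mulOp_apply_ae hw f]
    with x h1 h2 h3
  rw [ContinuousLinearMap.comp_apply, h1, h2, h3, smul_smul, Complex.ofReal_mul]

theorem matOp_comp_mulOp {w : Space → ℝ} (hw : MemLp w ⊤ (volume : Measure Space))
    (A : Matrix (Fin 4) (Fin 4) ℂ) : matOp A ∘L mulOp w = mulOp w ∘L matOp A := by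
  ext1 f
  refine Lp.ext ?_
  filter_upwards [mulOp_apply_ae hw f, mulOp_apply_ae hw (matOp A f), matOp_apply_ae A f,
    matOp_apply_ae A (mulOp w f)] with x h1 h2 h3 h4
  rw [ContinuousLinearMap.comp_apply, ContinuousLinearMap.comp_apply, h2, h3, h4, h1, map_smul]

theorem beta_mul_beta : beta * beta = 1 := by
  ext i j
  fin_cases i <;> fin_cases j <;> simp [beta, Matrix.mul_apply, Fin.sum_univ_four]

theorem matOp_beta_mul_matOp_beta : matOp beta * matOp beta = 1 := by
  ext1 f
  refine Lp.ext ?_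
  filter_upwards [matOp_apply_ae beta f, matOp_apply_ae beta (matOp beta f)] with x h1 h2
  rw [mul_apply_eq_comp, h2, h1, one_apply_eq_self,
    ← mul_apply_eq_comp, ← map_mul, beta_mul_beta, map_one,
    one_apply_eq_self]

/-! ### Convolution with an integrable kernel on `L²` -/

section Young

variable {k : Space → Spinor →L[ℂ] Spinor}

/-- Cauchy–Schwarz for the measure `N dμ`: the quadratic polynomial `s ↦ ∫ N (s - g)²` is
nonnegative, so its discriminant is at most zero. Integrability of `N g` follows from `2 g ≤ 1 +
g²`. -/
theorem sq_integral_mul_le {μ : Measure Space} {N g : Space → ℝ} (hN0 : ∀ x, 0 ≤ N x)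
    (hg0 : ∀ x, 0 ≤ g x)
    (hg : AEStronglyMeasurable g μ) (hN : Integrable N μ)
    (hNg : Integrable (fun x => N x * g x ^ 2) μ) :
    (∫ x, N x * g x ∂μ) ^ 2 ≤ (∫ x, N x ∂μ) * ∫ x, N x * g x ^ 2 ∂μ := by
  have key (s : ℝ) : 0 ≤ s ^ 2 * (∫ x, N x ∂μ) - 2 * s * (∫ x, N x * g x ∂μ)
      + ∫ x, N x * g x ^ 2 ∂μ := by
    have h1 : Integrable (fun x => N x * g x) μ := by
      refine (hN.add hNg).mono' (hN.1.mul hg) (ae_of_all _ fun x => ?_)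
      rw [Real.norm_of_nonneg (mul_nonneg (hN0 x) (hg0 x))]
      simp only [Pi.add_apply]
      nlinarith [hN0 x, mul_nonneg (hN0 x) (sq_nonneg (g x - 1)), mul_nonneg (hN0 x) (hg0 x)]
    have h2 : ∫ x, N x * (s - g x) ^ 2 ∂μ = s ^ 2 * (∫ x, N x ∂μ)
        - 2 * s * (∫ x, N x * g x ∂μ) + ∫ x, N x * g x ^ 2 ∂μ := by
      have h3 : (fun x => N x * (s - g x) ^ 2)
          = fun x => s ^ 2 * N x - 2 * s * (N x * g x) + N x * g x ^ 2 := by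
        ext x; ring
      have h4 := (hN.const_mul (s ^ 2)).sub (h1.const_mul (2 * s))
      simp only [Pi.sub_def] at h4
      rw [h3, integral_add h4 hNg,
        integral_sub (hN.const_mul _) (h1.const_mul _), integral_const_mul, integral_const_mul]
    rw [← h2]
    exact integral_nonneg fun x => mul_nonneg (hN0 x) (sq_nonneg _)
  have := discrim_le_zero (a := ∫ x, N x ∂μ) (b := -2 * (∫ x, N x * g x ∂μ))
    (c := ∫ x, N x * g x ^ 2 ∂μ) (fun s => by have := key s; nlinarith)
  rw [discrim] at this
  nlinarith

variable (hk : Integrable k)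
include hk

/-- Both `‖k‖` and `‖G‖²` are integrable, so their convolution exists almost everywhere. Absolute
convergence of `∫ k (x - y) (G y) dy` and Young's inequality are both derived from this. -/
theorem ae_integrable_norm_mul_sq (G : L2) :
    ∀ᵐ x : Space, Integrable (fun y => ‖k (x - y)‖ * ‖G y‖ ^ 2) := by
  have hG : Integrable (fun y => ‖G y‖ ^ 2) := (Lp.memLp G).integrable_norm_pow (by norm_num)
  filter_upwards [hG.ae_convolution_exists (ContinuousLinearMap.mul ℝ ℝ) hk.norm] with x hx
  refine hx.congr (ae_of_all _ fun y => ?_)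
  simp [mul_comm]

theorem integrable_apply_of_integrable_norm_mul_sq {G : L2} {x : Space}
    (hx : Integrable (fun y => ‖k (x - y)‖ * ‖G y‖ ^ 2)) :
    Integrable (fun y => k (x - y) (G y)) := by
  have hk' : Integrable (fun y => k (x - y)) := hk.comp_sub_left x
  refine (hk'.norm.add hx).mono' ?_ (ae_of_all _ fun y => ?_)
  · exact (ContinuousLinearMap.id ℂ (Spinor →L[ℂ] Spinor)).aestronglyMeasurable_comp₂ hk'.1
      (Lp.aestronglyMeasurable G)
  · refine ((k (x - y)).le_opNorm _).trans ?_
    simp only [Pi.add_apply]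
    nlinarith [norm_nonneg (k (x - y)), mul_nonneg (norm_nonneg (k (x - y)))
      (sq_nonneg (‖G y‖ - 1)), mul_nonneg (norm_nonneg (k (x - y))) (norm_nonneg (G y))]

theorem norm_integral_apply_sq_le {G : L2} {x : Space}
    (hx : Integrable (fun y => ‖k (x - y)‖ * ‖G y‖ ^ 2)) :
    ‖∫ y, k (x - y) (G y)‖ ^ 2 ≤ (∫ y, ‖k y‖) * ∫ y, ‖k (x - y)‖ * ‖G y‖ ^ 2 := by
  have hk' : Integrable (fun y => ‖k (x - y)‖) := (hk.comp_sub_left x).norm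
  have h1 : ‖∫ y, k (x - y) (G y)‖ ≤ ∫ y, ‖k (x - y)‖ * ‖G y‖ := by
    refine norm_integral_le_of_norm_le ?_ (ae_of_all _ fun y => (k (x - y)).le_opNorm _)
    refine (hk'.add hx).mono' (hk'.1.mul (Lp.aestronglyMeasurable G).norm)
      (ae_of_all _ fun y => ?_)
    rw [Real.norm_of_nonneg (by positivity)]
    simp only [Pi.add_apply]
    nlinarith [norm_nonneg (k (x - y)), mul_nonneg (norm_nonneg (k (x - y)))
      (sq_nonneg (‖G y‖ - 1)), mul_nonneg (norm_nonneg (k (x - y))) (norm_nonneg (G y))]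
  refine (pow_le_pow_left₀ (norm_nonneg _) h1 2).trans ?_
  refine (sq_integral_mul_le (fun _ => norm_nonneg _) (fun _ => norm_nonneg _)
    (Lp.aestronglyMeasurable G).norm hk' hx).trans_eq ?_
  rw [integral_sub_left_eq_self (fun y => ‖k y‖) volume x]

/-- Young's inequality for `L¹ * L²`: Cauchy–Schwarz with weight `‖k (x - y)‖` bounds the square
pointwise by `‖k‖₁ (‖k‖ * ‖G‖²)(x)`, and the integral of a convolution is the product of the
integrals. -/
theorem memLp_integral_apply (G : L2) :
    MemLp (fun x => ∫ y, k (x - y) (G y)) 2 (volume : Measure Space) ∧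
      ∫ x, ‖∫ y, k (x - y) (G y)‖ ^ 2 ≤ (∫ y, ‖k y‖) ^ 2 * ∫ y, ‖G y‖ ^ 2 := by
  have hG : Integrable (fun y => ‖G y‖ ^ 2) := (Lp.memLp G).integrable_norm_pow (by norm_num)
  have hm : AEStronglyMeasurable (fun x => ∫ y, k (x - y) (G y)) (volume : Measure Space) :=
    (AEStronglyMeasurable.convolution_integrand
      (ContinuousLinearMap.id ℂ (Spinor →L[ℂ] Spinor)).flip
      (Lp.aestronglyMeasurable G) hk.1).integral_prod_right'
  have hc : Integrable (fun x => ∫ y, ‖k (x - y)‖ * ‖G y‖ ^ 2) := by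
    refine (hG.integrable_convolution (ContinuousLinearMap.mul ℝ ℝ) hk.norm).congr
      (ae_of_all _ fun x => ?_)
    simp [convolution, mul_comm]
  have hci : ∫ x, ∫ y, ‖k (x - y)‖ * ‖G y‖ ^ 2 = (∫ y, ‖k y‖) * ∫ y, ‖G y‖ ^ 2 := by
    rw [mul_comm, ← ContinuousLinearMap.mul_apply' ℝ ℝ,
      ← integral_convolution (ContinuousLinearMap.mul ℝ ℝ) hG hk.norm]
    simp [convolution, mul_comm]
  have hb : ∀ᵐ x, ‖∫ y, k (x - y) (G y)‖ ^ 2 ≤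
      (∫ y, ‖k y‖) * ∫ y, ‖k (x - y)‖ * ‖G y‖ ^ 2 := by
    filter_upwards [ae_integrable_norm_mul_sq hk G] with x hx using norm_integral_apply_sq_le hk hx
  have hi : Integrable (fun x => ‖∫ y, k (x - y) (G y)‖ ^ 2) := by
    refine (hc.const_mul (∫ y, ‖k y‖)).mono' (hm.norm.pow 2) ?_
    filter_upwards [hb] with x hx
    rwa [Real.norm_of_nonneg (by positivity)]
  refine ⟨(memLp_two_iff_integrable_sq_norm hm).2 hi, ?_⟩
  refine (integral_mono_ae hi (hc.const_mul _) hb).trans_eq ?_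
  rw [integral_const_mul, hci]
  ring

/-- Convolution with an integrable operator-valued kernel, as a bounded operator on `L²`. -/
def convL : L2 →L[ℂ] L2 :=
  LinearMap.mkContinuous
    { toFun := fun G => (memLp_integral_apply hk G).1.toLp
      map_add' := fun F G => by
        rw [← MemLp.toLp_add]
        refine MemLp.toLp_congr _ _ ?_
        filter_upwards [ae_integrable_norm_mul_sq hk F, ae_integrable_norm_mul_sq hk G]
          with x hF hG
        rw [Pi.add_apply, ← integral_add (integrable_apply_of_integrable_norm_mul_sq hk hF)
          (integrable_apply_of_integrable_norm_mul_sq hk hG)]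
        refine integral_congr_ae ?_
        filter_upwards [Lp.coeFn_add F G] with y hy
        rw [hy, Pi.add_apply, map_add]
      map_smul' := fun c G => by
        rw [RingHom.id_apply, ← MemLp.toLp_const_smul]
        refine MemLp.toLp_congr _ _ (ae_of_all _ fun x => ?_)
        rw [Pi.smul_apply, ← integral_smul]
        refine integral_congr_ae ?_
        filter_upwards [Lp.coeFn_smul c G] with y hy
        rw [hy, Pi.smul_apply, map_smul] }
    (∫ y, ‖k y‖) fun G => by
      have h0 : 0 ≤ ∫ y, ‖k y‖ := integral_nonneg fun _ => norm_nonneg _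
      have hn (F : L2) : ‖F‖ ^ 2 = ∫ y, ‖F y‖ ^ 2 := by
        have := L2.inner_def (𝕜 := ℂ) F F
        rw [inner_self_eq_norm_sq_to_K] at this
        have h2 : (∫ y, inner ℂ (F y) (F y)) = ((∫ y, ‖F y‖ ^ 2 : ℝ) : ℂ) := by
          rw [← integral_complex_ofReal]
          congr 1; ext y
          rw [inner_self_eq_norm_sq_to_K]; simp
        rw [h2] at this
        exact Complex.ofReal_injective (by simpa using this)
      refine le_of_sq_le_sq ?_ (by positivity)
      rw [mul_pow, hn, hn]
      refine le_trans (le_of_eq ?_) (memLp_integral_apply hk G).2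
      refine integral_congr_ae ?_
      filter_upwards [(memLp_integral_apply hk G).1.coeFn_toLp] with x hx
      simp only [LinearMap.coe_mk, AddHom.coe_mk]
      rw [hx]

theorem convL_apply_ae (G : L2) :
    ∀ᵐ x : Space, Integrable (fun y => k (x - y) (G y)) ∧
      convL hk G x = ∫ y, k (x - y) (G y) := by
  filter_upwards [ae_integrable_norm_mul_sq hk G, (memLp_integral_apply hk G).1.coeFn_toLp]
    with x h1 h2
  exact ⟨integrable_apply_of_integrable_norm_mul_sq hk h1, h2⟩

end Young

/-! ### Inverses of functions of temperate growth -/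

open Asymptotics in
-- Since `(1/p)' = -p' · (1/p) · (1/p)`, bounds on the derivatives of `1/p` up to order `N` and on
-- those of `p'` give bounds up to order `N + 1` by the Leibniz rule. The lower bound on `‖p‖`
-- starts the induction.
theorem _root_.Function.HasTemperateGrowth.inv_of_le_norm {E : Type*} [NormedAddCommGroup E]
    [NormedSpace ℝ E] {p : E → ℂ} (hp : p.HasTemperateGrowth) {c : ℝ} (hc : 0 < c)
    (hpc : ∀ x, c ≤ ‖p x‖) : (fun x => (p x)⁻¹).HasTemperateGrowth := by
  have h0 (x : E) : p x ≠ 0 := norm_pos_iff.1 (hc.trans_le (hpc x))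
  have hs : ContDiff ℝ (⊤ : ℕ∞) (fun x => (p x)⁻¹) := hp.1.inv h0
  have hdp : (fderiv ℝ p).HasTemperateGrowth := by
    refine ⟨hp.1.fderiv_right (m := (⊤ : ℕ∞)) (by norm_cast), fun n => ?_⟩
    obtain ⟨k, C, h⟩ := hp.2 (n + 1)
    refine ⟨k, C, fun x => ?_⟩
    rw [norm_iteratedFDeriv_fderiv]
    exact h x
  let B : (E →L[ℝ] ℂ) →L[ℝ] ℂ →L[ℝ] (E →L[ℝ] ℂ) := (ContinuousLinearMap.lsmul ℝ ℂ).flip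
  have hd : fderiv ℝ (fun x => (p x)⁻¹)
      = fun x => B (B (-fderiv ℝ p x) (p x)⁻¹) (p x)⁻¹ := by
    ext1 x
    have h1 : HasFDerivAt p (fderiv ℝ p x) x :=
      (hp.1.differentiable (by simp)).differentiableAt.hasFDerivAt
    have h2 := (hasDerivAt_inv (h0 x)).comp_hasFDerivAt x h1
    refine h2.fderiv.trans ?_
    ext v
    simp [B]
    ring
  -- One exponent for all orders up to `N`, because the Leibniz sum mixes all lower orders.
  have key (N : ℕ) : ∃ k : ℕ, ∀ n ≤ N,
      iteratedFDeriv ℝ n (fun x => (p x)⁻¹) =O[⊤] (fun x => (1 + ‖x‖) ^ k) := by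
    have up {k l : ℕ} (h : k ≤ l) :
        (fun x : E => (1 + ‖x‖) ^ k) =O[⊤] (fun x : E => (1 + ‖x‖) ^ l) :=
      IsBigO.pow_of_le_right (Eventually.of_forall fun x => by simp) h
    have leib {F : Type _} [NormedAddCommGroup F] [NormedSpace ℝ F] {G : Type _}
        [NormedAddCommGroup G] [NormedSpace ℝ G] (b : F →L[ℝ] ℂ →L[ℝ] G) {f : E → F} {N k l : ℕ}
        (hf : ContDiff ℝ (⊤ : ℕ∞) f)
        (h1 : ∀ n ≤ N, iteratedFDeriv ℝ n f =O[⊤] (fun x => (1 + ‖x‖) ^ k))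
        (h2 : ∀ n ≤ N, iteratedFDeriv ℝ n (fun x => (p x)⁻¹) =O[⊤] (fun x => (1 + ‖x‖) ^ l)) :
        ∀ n ≤ N, iteratedFDeriv ℝ n (fun x => b (f x) (p x)⁻¹)
          =O[⊤] (fun x => (1 + ‖x‖) ^ (k + l)) := by
      intro n hn
      have est (x : E) : ‖iteratedFDeriv ℝ n (fun x => b (f x) (p x)⁻¹) x‖ ≤
          ‖b‖ * ∑ i ∈ Finset.range (n + 1), (n.choose i) *
            ‖iteratedFDeriv ℝ i f x‖ * ‖iteratedFDeriv ℝ (n - i) (fun x => (p x)⁻¹) x‖ :=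
        b.norm_iteratedFDeriv_le_of_bilinear hf hs x (mod_cast le_top)
      refine (IsBigO.of_norm_le est).trans (.const_mul_left (.fun_sum fun i hi ↦ ?_) _)
      simp_rw [mul_assoc, pow_add]
      have := Finset.mem_range.1 hi
      exact .const_mul_left (.mul (h1 i (by omega)).norm_left (h2 (n - i) (by omega)).norm_left) _
    induction N with
    | zero =>
      refine ⟨0, fun n hn => ?_⟩
      obtain rfl : n = 0 := by omega
      refine IsBigO.of_bound c⁻¹ (Eventually.of_forall fun x => ?_)
      rw [norm_iteratedFDeriv_zero, norm_inv]
      simpa using inv_anti₀ hc (hpc x)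
    | succ N ih =>
      obtain ⟨k, hk⟩ := ih
      obtain ⟨l, hl⟩ := hdp.neg.isBigO_uniform N
      have h1 := leib B hdp.neg.1 hl hk
      have hs1 : ContDiff ℝ (⊤ : ℕ∞) (fun x => B ((-fderiv ℝ p) x) (p x)⁻¹) :=
        (B.isBoundedBilinearMap.contDiff).comp (hdp.neg.1.prodMk hs)
      have h2 := leib B hs1 h1 hk
      -- The bracket is the growth of `p'` and of two factors `1/p`; the leading `k` makes room for
      -- the case `n = 0`.
      refine ⟨k + (l + k + k), fun n hn => ?_⟩
      rcases n with _ | n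
      · exact (hk 0 (by omega)).trans (up (by omega))
      · have h3 := (h2 n (by omega)).trans (up (show l + k + k ≤ k + (l + k + k) by omega))
        refine IsBigO.trans (IsBigO.of_norm_le fun x => ?_) h3.norm_left
        rw [← norm_iteratedFDeriv_fderiv, hd]
        rfl
  rw [Function.hasTemperateGrowth_iff_isBigO]
  exact ⟨hs, fun n => (key n).imp fun k hk => hk n le_rfl⟩

/-! ### Constant matrices acting on tempered distributions -/

/-- The operator `(A u)(φ) = A (u φ)` on tempered distributions. -/
def distMat (A : Matrix (Fin 4) (Fin 4) ℂ) : 𝓢'(Space, Spinor) →L[ℂ] 𝓢'(Space, Spinor) :=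
  PointwiseConvergenceCLM.postcomp 𝓢(Space, ℂ) (Matrix.toEuclideanCLM (n := Fin 4) (𝕜 := ℂ) A)

theorem distMat_apply_apply (A : Matrix (Fin 4) (Fin 4) ℂ) (u : 𝓢'(Space, Spinor))
    (φ : 𝓢(Space, ℂ)) :
    distMat A u φ = Matrix.toEuclideanCLM (n := Fin 4) (𝕜 := ℂ) A (u φ) := rfl

theorem distMat_mul (A B : Matrix (Fin 4) (Fin 4) ℂ) (u : 𝓢'(Space, Spinor)) :
    distMat (A * B) u = distMat A (distMat B u) := by
  ext1 φ
  simp [distMat_apply_apply]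

theorem distMat_add (A B : Matrix (Fin 4) (Fin 4) ℂ) (u : 𝓢'(Space, Spinor)) :
    distMat (A + B) u = distMat A u + distMat B u := by
  ext1 φ
  simp [distMat_apply_apply]

theorem distMat_smul (c : ℂ) (A : Matrix (Fin 4) (Fin 4) ℂ) (u : 𝓢'(Space, Spinor)) :
    distMat (c • A) u = c • distMat A u := by
  ext1 φ
  simp [distMat_apply_apply]

theorem distMat_one (u : 𝓢'(Space, Spinor)) : distMat 1 u = u := by
  ext1 φ
  simp [distMat_apply_apply]

theorem lineDerivOp_distMat (A : Matrix (Fin 4) (Fin 4) ℂ) (e : Space) (u : 𝓢'(Space, Spinor)) :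
    ∂_{e} (distMat A u) = distMat A (∂_{e} u) := rfl

theorem fourierMultiplierCLM_distMat (A : Matrix (Fin 4) (Fin 4) ℂ) (g : Space → ℂ)
    (u : 𝓢'(Space, Spinor)) :
    fourierMultiplierCLM Spinor g (distMat A u) = distMat A (fourierMultiplierCLM Spinor g u) := rfl

theorem distMat_coe (A : Matrix (Fin 4) (Fin 4) ℂ) (f : L2) :
    distMat A (f : 𝓢'(Space, Spinor)) = (matOp A f : L2) := by
  ext1 φ
  rw [distMat_apply_apply, Lp.toTemperedDistribution_apply, Lp.toTemperedDistribution_apply]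
  have hi : Integrable (fun x => φ x • f x) :=
    memLp_one_iff_integrable.1 ((Lp.memLp f).smul (φ.memLp 2 volume))
  rw [← ContinuousLinearMap.integral_comp_comm _ hi]
  refine integral_congr_ae ?_
  filter_upwards [matOp_apply_ae A f] with x hx
  rw [hx, map_smul]

theorem _root_.TemperedDistribution.MemSobolev.distMat {s : ℝ} {u : 𝓢'(Space, Spinor)}
    (hu : MemSobolev s 2 u) (A : Matrix (Fin 4) (Fin 4) ℂ) : MemSobolev s 2 (distMat A u) := by
  obtain ⟨f, hf⟩ := hu
  refine ⟨matOp A f, ?_⟩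
  rw [← distMat_coe, ← hf]
  rfl

/-! ### The Dirac operator on tempered distributions -/

/-- The operator `-i α·∇ + m β + c` on tempered distributions. -/
def distDirac (m : ℝ) (c : ℂ) (u : 𝓢'(Space, Spinor)) : 𝓢'(Space, Spinor) :=
  (∑ j : Fin 3, (-Complex.I) • distMat (alpha j) (∂_{basisVec j} u)) +
    (m : ℂ) • distMat beta u + c • u

theorem distDirac_coe (m : ℝ) (c : ℂ) (f : H1) :
    distDirac m c ((f : L2) : 𝓢'(Space, Spinor)) =
      ((freeDirac m f + c • (f : L2) : L2) : 𝓢'(Space, Spinor)) := by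
  have h : (freeDirac m f : L2) = (∑ j : Fin 3, (-Complex.I) • matOp (alpha j) (weakDeriv j f)) +
      (m : ℂ) • matOp beta (f : L2) := by
    change ((∑ j : Fin 3, (-Complex.I) • (matOp (alpha j) : L2 →ₗ[ℂ] L2) ∘ₗ weakDeriv j) +
      (m : ℂ) • (matOp beta : L2 →ₗ[ℂ] L2) ∘ₗ H1.subtype) f = _
    simp
    rfl
  rw [h, ← Lp.toTemperedDistributionCLM_apply (_ + _)]
  simp only [map_add, map_sum, map_smul]
  simp only [Lp.toTemperedDistributionCLM_apply, ← distMat_coe, distDirac]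
  have h2 (j : Fin 3) : (weakDeriv j f : 𝓢'(Space, Spinor))
      = ∂_{basisVec j} ((f : L2) : 𝓢'(Space, Spinor)) := (exists_weakDeriv j f).choose_spec
  simp only [h2]

/-! ### Clifford relations and the factorisation of the Helmholtz operator. -/

theorem alpha_anticomm (j k : Fin 3) :
    alpha j * alpha k + alpha k * alpha j = if j = k then 2 else 0 := by
  have h2 : (2 : Matrix (Fin 4) (Fin 4) ℂ) = !![2, 0, 0, 0; 0, 2, 0, 0; 0, 0, 2, 0; 0, 0, 0, 2] := by
    ext a b; fin_cases a <;> fin_cases b <;> simp [Matrix.ofNat_apply]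
  have h0 : (0 : Matrix (Fin 4) (Fin 4) ℂ) = !![0, 0, 0, 0; 0, 0, 0, 0; 0, 0, 0, 0; 0, 0, 0, 0] := by
    ext a b; fin_cases a <;> fin_cases b <;> rfl
  fin_cases j <;> fin_cases k <;> simp [alpha, h2, h0, one_add_one_eq_two]

theorem alpha_mul_beta (j : Fin 3) : alpha j * beta = -(beta * alpha j) := by
  fin_cases j <;> ext a b <;> fin_cases a <;> fin_cases b <;> simp [alpha, beta]

/-- The operator `α·∇` on tempered distributions. -/
def distAlphaGrad (u : 𝓢'(Space, Spinor)) : 𝓢'(Space, Spinor) :=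
  ∑ j : Fin 3, distMat (alpha j) (∂_{basisVec j} u)

theorem distDirac_eq (m : ℝ) (c : ℂ) (u : 𝓢'(Space, Spinor)) :
    distDirac m c u = (-Complex.I) • distAlphaGrad u + (m : ℂ) • distMat beta u + c • u := by
  rw [distDirac, distAlphaGrad, Finset.smul_sum]

theorem lineDerivOp_lineDerivOp_comm (e e' : Space) (u : 𝓢'(Space, Spinor)) :
    ∂_{e} (∂_{e'} u) = ∂_{e'} (∂_{e} u) := by
  simp only [TemperedDistribution.lineDeriv_eq_fourierMultiplierCLM, map_smul]
  rw [fourierMultiplierCLM_fourierMultiplierCLM_apply (by fun_prop) (by fun_prop),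
    fourierMultiplierCLM_fourierMultiplierCLM_apply (by fun_prop) (by fun_prop),
    mul_comm (fun x => ((inner ℝ x e' : ℝ) : ℂ))]

open Laplacian

/-- Mixed derivatives commute, so the double sum may be written with `α_j α_k` or with `α_k α_j`.
Adding the two versions leaves the anticommutators `2 δ_jk`, hence twice the Laplacian. -/
theorem distAlphaGrad_distAlphaGrad (u : 𝓢'(Space, Spinor)) :
    distAlphaGrad (distAlphaGrad u) = Δ u := by
  have h1 : distAlphaGrad (distAlphaGrad u) = ∑ j : Fin 3, ∑ k : Fin 3,
      distMat (alpha j * alpha k) (∂_{basisVec j} (∂_{basisVec k} u)) := by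
    simp only [distAlphaGrad, LineDeriv.lineDerivOp_sum, map_sum, lineDerivOp_distMat, distMat_mul]
  have h2 : distAlphaGrad (distAlphaGrad u) = ∑ j : Fin 3, ∑ k : Fin 3,
      distMat (alpha k * alpha j) (∂_{basisVec j} (∂_{basisVec k} u)) := by
    rw [h1, Finset.sum_comm]
    exact Finset.sum_congr rfl fun j _ => Finset.sum_congr rfl fun k _ => by
      rw [lineDerivOp_lineDerivOp_comm]
  have h3 : (2 : ℂ) • distAlphaGrad (distAlphaGrad u) = (2 : ℂ) • Δ u := by
    rw [laplacian_eq_sum (EuclideanSpace.basisFun (Fin 3) ℝ), two_smul ℂ (distAlphaGrad _)]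
    nth_rw 1 [h1]
    rw [h2, ← Finset.sum_add_distrib, Finset.smul_sum]
    refine Finset.sum_congr rfl fun j _ => ?_
    rw [← Finset.sum_add_distrib, Finset.sum_eq_single j]
    · have h4 : (2 : Matrix (Fin 4) (Fin 4) ℂ) = (2 : ℂ) • 1 := by
        rw [two_smul, one_add_one_eq_two]
      rw [← distMat_add, alpha_anticomm, if_pos rfl, h4, distMat_smul, distMat_one]
      simp [basisVec]
    · intro k _ hk
      rw [← distMat_add, alpha_anticomm, if_neg hk.symm]
      ext1 φ
      simp [distMat_apply_apply]
    · simp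
  exact smul_right_injective _ two_ne_zero h3

theorem distAlphaGrad_distMat_beta (u : 𝓢'(Space, Spinor)) :
    distAlphaGrad (distMat beta u) = - distMat beta (distAlphaGrad u) := by
  simp only [distAlphaGrad, map_sum, lineDerivOp_distMat, ← distMat_mul, ← Finset.sum_neg_distrib]
  refine Finset.sum_congr rfl fun j _ => ?_
  rw [alpha_mul_beta, ← neg_one_smul ℂ, distMat_smul, neg_one_smul ℂ (distMat _ _)]

theorem distAlphaGrad_add (u v : 𝓢'(Space, Spinor)) :
    distAlphaGrad (u + v) = distAlphaGrad u + distAlphaGrad v := by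
  simp only [distAlphaGrad, LineDeriv.lineDerivOp_add, map_add, Finset.sum_add_distrib]

theorem distAlphaGrad_smul (c : ℂ) (u : 𝓢'(Space, Spinor)) :
    distAlphaGrad (c • u) = c • distAlphaGrad u := by
  simp only [distAlphaGrad, LineDeriv.lineDerivOp_smul, map_smul, Finset.smul_sum]

/-- With `D = -iα·∇ + mβ` this is `(D + c)(D - c) = D² - c²`. The cross terms in `D²` cancel since
`β` anticommutes with each `α_j`, leaving `D² = m² - Δ`. -/
theorem distDirac_distDirac_neg (m : ℝ) (c : ℂ) (u : 𝓢'(Space, Spinor)) :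
    distDirac m c (distDirac m (-c) u) = ((m : ℂ) ^ 2 - c ^ 2) • u - Δ u := by
  have hb : distMat beta (distMat beta u) = u := by rw [← distMat_mul, beta_mul_beta, distMat_one]
  simp only [distDirac_eq, distAlphaGrad_add, distAlphaGrad_smul, map_add, map_smul,
    distAlphaGrad_distAlphaGrad, distAlphaGrad_distMat_beta, hb]
  match_scalars
  · linear_combination Complex.I_sq
  all_goals ring

/-! ### The resolvent of the free Dirac operator as a Fourier multiplier -/

/-- The parameter `z` does not belong to `(-∞, 0]`. -/
theorem exists_le_norm_add_of_mem_slitPlane {z : ℂ} (hz : z ∈ Complex.slitPlane) :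
    ∃ c : ℝ, 0 < c ∧ ∀ t : ℝ, 0 ≤ t → c * (1 + t) ≤ ‖(t : ℂ) + z‖ := by
  rcases Complex.mem_slitPlane_iff.1 hz with h | h
  · refine ⟨min 1 z.re, lt_min one_pos h, fun t ht => ?_⟩
    refine le_trans ?_ (Complex.re_le_norm _)
    simp only [Complex.add_re, Complex.ofReal_re]
    nlinarith [min_le_left 1 z.re, min_le_right 1 z.re]
  · have hz0 : 0 < ‖z‖ := norm_pos_iff.2 fun h0 => h (by simp [h0])
    have him : 0 < |z.im| := abs_pos.2 h
    -- From `|z.im| ≤ ‖t + z‖` and `t ≤ ‖t + z‖ + ‖z‖` one gets `|z.im| (1 + t) ≤ (1 + |z.im| + ‖z‖)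
    -- ‖t + z‖`.
    refine ⟨|z.im| / (1 + |z.im| + ‖z‖), by positivity, fun t ht => ?_⟩
    have h1 : |z.im| ≤ ‖(t : ℂ) + z‖ := by
      simpa using Complex.abs_im_le_norm ((t : ℂ) + z)
    have h2 : t - ‖z‖ ≤ ‖(t : ℂ) + z‖ := by
      have := norm_sub_le ((t : ℂ) + z) z
      rw [add_sub_cancel_right, Complex.norm_real, Real.norm_of_nonneg ht] at this
      linarith
    rw [div_mul_eq_mul_div, div_le_iff₀ (by positivity)]
    nlinarith [norm_nonneg ((t : ℂ) + z)]

/-- The symbol `1 / (4 π² |ξ|² + z)` of the resolvent of the Laplacian. -/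
def yukawaSymbol (z : ℂ) (ξ : Space) : ℂ := ((((2 * Real.pi) ^ 2 * ‖ξ‖ ^ 2 : ℝ) : ℂ) + z)⁻¹

section Symbol

variable {z : ℂ} (hz : z ∈ Complex.slitPlane)
include hz

theorem yukawaSymbol_hasTemperateGrowth : (yukawaSymbol z).HasTemperateGrowth := by
  obtain ⟨c, hc, h⟩ := exists_le_norm_add_of_mem_slitPlane hz
  refine Function.HasTemperateGrowth.inv_of_le_norm (by fun_prop) hc fun ξ => ?_
  refine le_trans ?_ (h ((2 * Real.pi) ^ 2 * ‖ξ‖ ^ 2) (by positivity))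
  exact le_mul_of_one_le_right hc.le (le_add_of_nonneg_right (by positivity))

theorem yukawaSymbol_denom_ne_zero (ξ : Space) :
    (((2 * Real.pi) ^ 2 * ‖ξ‖ ^ 2 : ℝ) : ℂ) + z ≠ 0 := by
  obtain ⟨c, hc, h⟩ := exists_le_norm_add_of_mem_slitPlane hz
  refine norm_pos_iff.1 (lt_of_lt_of_le ?_ (h ((2 * Real.pi) ^ 2 * ‖ξ‖ ^ 2) (by positivity)))
  positivity

open Laplacian

/-- In the normalisation `e^{-2πi x·ξ}` the operator `z - Δ` has symbol `(2π)²|ξ|² + z`, so the two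
multipliers compose to the multiplier `1`. -/
theorem smul_sub_laplacian_yukawa (u : 𝓢'(Space, Spinor)) :
    z • fourierMultiplierCLM Spinor (yukawaSymbol z) u -
      Δ (fourierMultiplierCLM Spinor (yukawaSymbol z) u) = u := by
  have ht := yukawaSymbol_hasTemperateGrowth hz
  have h1 : ∀ w : 𝓢'(Space, Spinor), z • w - Δ w =
      fourierMultiplierCLM Spinor (fun ξ => (((2 * Real.pi) ^ 2 * ‖ξ‖ ^ 2 : ℝ) : ℂ) + z) w := by
    intro w
    have e : (fun ξ : Space => (((2 * Real.pi) ^ 2 * ‖ξ‖ ^ 2 : ℝ) : ℂ) + z) =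
        ((((2 * Real.pi) ^ 2 : ℝ) : ℂ) • fun ξ : Space => ((‖ξ‖ ^ 2 : ℝ) : ℂ)) + fun _ => z := by
      ext ξ; simp
    have h2 : fourierMultiplierCLM Spinor (fun ξ : Space =>
          (((2 * Real.pi) ^ 2 * ‖ξ‖ ^ 2 : ℝ) : ℂ) + z) w =
        fourierMultiplierCLM Spinor ((((2 * Real.pi) ^ 2 : ℝ) : ℂ) •
          fun ξ : Space => ((‖ξ‖ ^ 2 : ℝ) : ℂ)) w + fourierMultiplierCLM Spinor (fun _ => z) w := by
      rw [e]
      simp only [fourierMultiplierCLM_apply]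
      rw [smulLeftCLM_add (by fun_prop) (by fun_prop), _root_.add_apply,
        FourierTransform.fourierInv_add]
    rw [h2, fourierMultiplierCLM_smul (by fun_prop), fourierMultiplierCLM_const,
      laplacian_eq_fourierMultiplierCLM, add_comm, sub_eq_add_neg]
    congr 1
    rw [neg_smul, neg_neg, _root_.smul_apply, Complex.coe_smul]
  rw [h1, fourierMultiplierCLM_fourierMultiplierCLM_apply ht (by fun_prop)]
  have h3 : (yukawaSymbol z * fun ξ => (((2 * Real.pi) ^ 2 * ‖ξ‖ ^ 2 : ℝ) : ℂ) + z)
      = fun _ => 1 := by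
    ext ξ
    exact inv_mul_cancel₀ (yukawaSymbol_denom_ne_zero hz ξ)
  rw [h3, fourierMultiplierCLM_const]
  simp

theorem lineDerivOp_yukawa (e : Space) (u : 𝓢'(Space, Spinor)) :
    ∂_{e} (fourierMultiplierCLM Spinor (yukawaSymbol z) u) =
      fourierMultiplierCLM Spinor (yukawaSymbol z) (∂_{e} u) := by
  have ht := yukawaSymbol_hasTemperateGrowth hz
  rw [TemperedDistribution.lineDeriv_eq_fourierMultiplierCLM,
    TemperedDistribution.lineDeriv_eq_fourierMultiplierCLM, map_smul,
    fourierMultiplierCLM_fourierMultiplierCLM_apply ht (by fun_prop),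
    fourierMultiplierCLM_fourierMultiplierCLM_apply (by fun_prop) ht, mul_comm (yukawaSymbol z)]

theorem yukawa_smul_sub_laplacian (u : 𝓢'(Space, Spinor)) :
    fourierMultiplierCLM Spinor (yukawaSymbol z) (z • u - Δ u) = u := by
  rw [map_sub, map_smul]
  conv_rhs => rw [← smul_sub_laplacian_yukawa hz u]
  simp only [TemperedDistribution.laplacian_eq_sum (EuclideanSpace.basisFun (Fin 3) ℝ), map_sum,
    lineDerivOp_yukawa hz]

theorem distDirac_yukawa (m : ℝ) (c : ℂ) (u : 𝓢'(Space, Spinor)) :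
    distDirac m c (fourierMultiplierCLM Spinor (yukawaSymbol z) u) =
      fourierMultiplierCLM Spinor (yukawaSymbol z) (distDirac m c u) := by
  simp only [distDirac, map_add, map_sum, map_smul, fourierMultiplierCLM_distMat,
    lineDerivOp_yukawa hz]

/-- The Bessel weight `1 + |ξ|²` times the symbol is bounded, because the denominator is at least `c
(1 + |ξ|²)`. -/
theorem memSobolev_two_yukawa (f : L2) :
    MemSobolev 2 2 (fourierMultiplierCLM Spinor (yukawaSymbol z) (f : 𝓢'(Space, Spinor))) := by
  have ht := yukawaSymbol_hasTemperateGrowth hz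
  have h0 : MemSobolev 0 2 (f : 𝓢'(Space, Spinor)) := memSobolev_zero_iff.2 ⟨f, rfl⟩
  rw [show (2 : ℝ) = 2 + 0 by norm_num, ← memSobolev_besselPotential_iff, besselPotential,
    fourierMultiplierCLM_fourierMultiplierCLM_apply ht (by fun_prop)]
  refine h0.fourierMultiplierCLM_of_bounded (ht.mul (by fun_prop)) ?_
  obtain ⟨c, hc, h⟩ := exists_le_norm_add_of_mem_slitPlane hz
  refine ⟨c⁻¹, fun ξ => ?_⟩
  have h1 := h ((2 * Real.pi) ^ 2 * ‖ξ‖ ^ 2) (by positivity)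
  have h2 : ‖ξ‖ ^ 2 ≤ (2 * Real.pi) ^ 2 * ‖ξ‖ ^ 2 :=
    le_mul_of_one_le_left (by positivity) (one_le_pow₀ (by linarith [Real.two_le_pi]))
  rw [Pi.mul_apply, norm_mul, yukawaSymbol, norm_inv, Complex.norm_real,
    Real.norm_of_nonneg (by positivity), div_self two_ne_zero, Real.rpow_one]
  have h3 : 0 < c * (1 + ‖ξ‖ ^ 2) := by positivity
  have h4 : c * (1 + ‖ξ‖ ^ 2) ≤ ‖(((2 * Real.pi) ^ 2 * ‖ξ‖ ^ 2 : ℝ) : ℂ) + z‖ :=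
    le_trans (by gcongr) h1
  refine (mul_le_mul_of_nonneg_right (inv_anti₀ h3 h4) (by positivity)).trans_eq ?_
  field_simp

end Symbol

theorem memSobolev_distDirac {m : ℝ} {c : ℂ} {u : 𝓢'(Space, Spinor)} (hu : MemSobolev 2 2 u) :
    MemSobolev 1 2 (distDirac m c u) := by
  have h1 : MemSobolev 1 2 u := hu.mono (by norm_num)
  have hd (j : Fin 3) : MemSobolev 1 2 (distMat (alpha j) (∂_{basisVec j} u)) := by
    have := hu.lineDerivOp (m := basisVec j)
    norm_num at this
    exact this.distMat _
  rw [distDirac, Fin.sum_univ_three]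
  exact ((((hd 0).smul _).add ((hd 1).smul _)).add ((hd 2).smul _)).add ((h1.distMat _).smul _)
    |>.add (h1.smul _)

/-! ### Density of Schwartz functions and the free resolvent. -/

theorem eq_of_eqOn_schwartz {X : Type*} [TopologicalSpace X] [T2Space X] {F₁ F₂ : L2 → X}
    (h₁ : Continuous F₁) (h₂ : Continuous F₂)
    (h : ∀ f : 𝓢(Space, Spinor), F₁ (f.toLp 2) = F₂ (f.toLp 2)) : F₁ = F₂ :=
  (SchwartzMap.denseRange_toLpCLM (F := Spinor) (E := Space) (μ := volume)
    (p := 2) (by simp)).equalizer h₁ h₂ (funext h)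

/-- A bounded operator which acts as `(H + a) (m² - a² - Δ)⁻¹` on Schwartz functions is the
resolvent of the free Dirac operator. -/
theorem isResolventAt_freeDirac {m : ℝ} {a : ℂ}
    (hz : (m : ℂ) ^ 2 - a ^ 2 ∈ Complex.slitPlane) {Φ : L2 →L[ℂ] L2}
    (hΦ : ∀ f : 𝓢(Space, Spinor), (Φ (f.toLp 2) : 𝓢'(Space, Spinor)) =
      distDirac m a (fourierMultiplierCLM Spinor (yukawaSymbol ((m : ℂ) ^ 2 - a ^ 2))
        (f : 𝓢'(Space, Spinor)))) :
    IsResolventAt (freeDirac m) a Φ := by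
  set T := fourierMultiplierCLM Spinor (yukawaSymbol ((m : ℂ) ^ 2 - a ^ 2)) with hT
  have hcont (m : ℝ) (c : ℂ) : Continuous (distDirac m c) := by
    unfold distDirac
    refine ((continuous_finsetSum _ fun j _ => ?_).add ?_).add (continuous_const_smul c)
    · exact ((distMat (alpha j)).continuous.comp
        (LineDeriv.lineDerivOpCLM ℂ 𝓢'(Space, Spinor) (basisVec j)).continuous).const_smul (-Complex.I)
    · exact (distMat beta).continuous.const_smul (m : ℂ)
  -- Both sides are continuous from `L²` to tempered distributions and agree on the dense set of
  -- Schwartz functions.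
  have h (G : L2) : (Φ G : 𝓢'(Space, Spinor)) = distDirac m a (T (G : 𝓢'(Space, Spinor))) := by
    have hι := (Lp.toTemperedDistributionCLM Spinor (volume : Measure Space) 2).continuous
    refine congrFun (eq_of_eqOn_schwartz (hι.comp Φ.continuous)
      ((hcont m a).comp (T.continuous.comp hι)) fun f => ?_) G
    have h1 := hΦ f
    rw [← Lp.toTemperedDistribution_toLp_eq (p := 2) f] at h1
    exact h1
  have hneg (u : 𝓢'(Space, Spinor)) :
      distDirac m (-a) (distDirac m a u) = ((m : ℂ) ^ 2 - a ^ 2) • u - Laplacian.laplacian u := by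
    have := distDirac_distDirac_neg m (-a) u
    rwa [neg_neg, neg_sq] at this
  refine ⟨fun y => ?_, fun x => ?_⟩
  · have hd : Φ y ∈ H1 := by
      change MemSobolev 1 2 (Φ y : 𝓢'(Space, Spinor))
      rw [h]
      exact memSobolev_distDirac (memSobolev_two_yukawa hz y)
    refine ⟨hd, ?_⟩
    apply toTemperedDistribution_inj
    have := distDirac_coe m (-a) ⟨Φ y, hd⟩
    rw [neg_smul, ← sub_eq_add_neg] at this
    refine this.symm.trans ?_
    change distDirac m (-a) (Φ y : 𝓢'(Space, Spinor)) = _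
    rw [h, hneg, hT, smul_sub_laplacian_yukawa hz]
  · apply toTemperedDistribution_inj
    have := distDirac_coe m (-a) x
    rw [neg_smul, ← sub_eq_add_neg] at this
    rw [h, ← this, hT, distDirac_yukawa hz, distDirac_distDirac_neg,
      ← yukawa_smul_sub_laplacian hz ((x : L2) : 𝓢'(Space, Spinor))]
    simp only [yukawa_smul_sub_laplacian hz]

/-! ### The Yukawa kernel -/

/-- The radial profile `e^{-κ s} / (4 π s)` of the Yukawa potential. -/
def yuk (κ : ℂ) (s : ℝ) : ℂ := Complex.exp (-κ * s) / (4 * Real.pi * s)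

/-- The function `yuk' (s) / s`. -/
def yukD (κ : ℂ) (s : ℝ) : ℂ := -((1 + κ * s) * Complex.exp (-κ * s)) / (4 * Real.pi * s ^ 3)

/-- The function `yukD' (s) / s`. -/
def yukDD (κ : ℂ) (s : ℝ) : ℂ :=
  (3 + 3 * (κ * s) + (κ * s) ^ 2) * Complex.exp (-κ * s) / (4 * Real.pi * s ^ 5)

theorem hasDerivAt_exp_neg_mul (κ : ℂ) (s : ℝ) :
    HasDerivAt (fun s : ℝ => Complex.exp (-κ * s)) (-κ * Complex.exp (-κ * s)) s := by
  have h : HasDerivAt (fun s : ℝ => -κ * (s : ℂ)) (-κ * 1) s :=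
    (Complex.ofRealCLM.hasDerivAt (x := s)).const_mul (-κ)
  exact h.cexp.congr_deriv (by ring)

theorem hasDerivAt_yuk (κ : ℂ) {s : ℝ} (hs : s ≠ 0) :
    HasDerivAt (yuk κ) (s * yukD κ s) s := by
  have hs' : (s : ℂ) ≠ 0 := Complex.ofReal_ne_zero.2 hs
  have hπ : (Real.pi : ℂ) ≠ 0 := Complex.ofReal_ne_zero.2 Real.pi_ne_zero
  have h1 := hasDerivAt_exp_neg_mul κ s
  have h2 : HasDerivAt (fun s : ℝ => 4 * (Real.pi : ℂ) * (s : ℂ)) (4 * Real.pi * 1) s :=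
    (Complex.ofRealCLM.hasDerivAt (x := s)).const_mul _
  refine (h1.div h2 (by simp [hs', hπ])).congr_deriv ?_
  rw [yukD]
  field_simp
  ring

theorem hasDerivAt_yukD (κ : ℂ) {s : ℝ} (hs : s ≠ 0) :
    HasDerivAt (yukD κ) (s * yukDD κ s) s := by
  have hs' : (s : ℂ) ≠ 0 := Complex.ofReal_ne_zero.2 hs
  have hπ : (Real.pi : ℂ) ≠ 0 := Complex.ofReal_ne_zero.2 Real.pi_ne_zero
  have h0 : HasDerivAt (fun s : ℝ => (s : ℂ)) 1 s := Complex.ofRealCLM.hasDerivAt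
  have h1 := hasDerivAt_exp_neg_mul κ s
  have h2 := (h0.pow 3).const_mul (4 * (Real.pi : ℂ))
  have h3 := (((h0.const_mul κ).const_add 1).mul h1).neg
  refine (h3.div h2 (by simp [hs', hπ])).congr_deriv ?_
  rw [yukDD]
  simp only [Pi.mul_apply, Pi.neg_apply, Pi.pow_apply]
  field_simp
  ring

/-- The regularised norm `√(|x|² + δ²)`. -/
def regNorm (δ : ℝ) (x : Space) : ℝ := Real.sqrt (‖x‖ ^ 2 + δ ^ 2)

theorem regNorm_sq (δ : ℝ) (x : Space) : regNorm δ x ^ 2 = ‖x‖ ^ 2 + δ ^ 2 :=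
  Real.sq_sqrt (by positivity)

theorem regNorm_zero_left (x : Space) : regNorm 0 x = ‖x‖ := by
  rw [regNorm]; simp

theorem norm_le_regNorm (δ : ℝ) (x : Space) : ‖x‖ ≤ regNorm δ x :=
  Real.le_sqrt_of_sq_le (by nlinarith [sq_nonneg δ])

theorem le_regNorm (δ : ℝ) (x : Space) : δ ≤ regNorm δ x :=
  Real.le_sqrt_of_sq_le (by nlinarith [sq_nonneg ‖x‖])

theorem continuous_regNorm (δ : ℝ) : Continuous (regNorm δ) := by
  unfold regNorm; fun_prop

theorem continuous_regNorm_left (x : Space) : Continuous fun δ => regNorm δ x := by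
  unfold regNorm; fun_prop

theorem hasLineDerivAt_regNorm {δ : ℝ} (hδ : 0 < δ) (x e : Space) :
    HasLineDerivAt ℝ (regNorm δ) (inner ℝ x e / regNorm δ x) x e := by
  have h1 : HasDerivAt (fun t : ℝ => x + t • e) e 0 := by
    simpa using ((hasDerivAt_id (0 : ℝ)).smul_const e).const_add x
  have h2 := (h1.norm_sq.add_const (δ ^ 2)).sqrt (by positivity)
  have h3 : HasDerivAt (fun t : ℝ => regNorm δ (x + t • e)) _ 0 := h2
  refine h3.congr_deriv ?_
  have : regNorm δ x = Real.sqrt (‖x‖ ^ 2 + δ ^ 2) := rfl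
  simp only [zero_smul, add_zero, ← this]
  rw [mul_div_mul_left _ _ two_ne_zero]

/-- The chain rule produces `⟨x, e⟩ / s` with `s = regNorm δ x`; writing the derivative of `g` as `s
g'` cancels the denominator, which is why `yukD` and `yukDD` carry a division by `s`. For `δ > 0`
the composite is differentiable at the origin too, so integration by parts needs no excised ball. -/
theorem _root_.HasDerivAt.hasLineDerivAt_comp_regNorm {g : ℝ → ℂ} {g' : ℂ} {δ : ℝ} (hδ : 0 < δ)
    {x : Space} (hg : HasDerivAt g (regNorm δ x * g') (regNorm δ x)) (e : Space) :
    HasLineDerivAt ℝ (fun x => g (regNorm δ x)) ((inner ℝ x e : ℝ) * g') x e := by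
  have h1 : HasDerivAt (fun t : ℝ => regNorm δ (x + t • e)) _ 0 := hasLineDerivAt_regNorm hδ x e
  have h2 := HasDerivAt.scomp (h := fun t : ℝ => regNorm δ (x + t • e)) (0 : ℝ)
    (by simpa using hg) h1
  have h3 : HasDerivAt (fun t : ℝ => g (regNorm δ (x + t • e))) _ 0 := h2
  refine h3.congr_deriv ?_
  have : (regNorm δ x : ℂ) ≠ 0 :=
    Complex.ofReal_ne_zero.2 (hδ.trans_le (le_regNorm δ x)).ne'
  rw [Complex.real_smul]
  push_cast
  field_simp

theorem hasLineDerivAt_yuk_regNorm (κ : ℂ) {δ : ℝ} (hδ : 0 < δ) (x e : Space) :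
    HasLineDerivAt ℝ (fun x => yuk κ (regNorm δ x))
      ((inner ℝ x e : ℝ) * yukD κ (regNorm δ x)) x e :=
  HasDerivAt.hasLineDerivAt_comp_regNorm hδ
    (hasDerivAt_yuk κ (hδ.trans_le (le_regNorm δ x)).ne') e

theorem hasLineDerivAt_inner_mul_yukD_regNorm (κ : ℂ) {δ : ℝ} (hδ : 0 < δ) (x e : Space) :
    HasLineDerivAt ℝ (fun x => ((inner ℝ x e : ℝ) : ℂ) * yukD κ (regNorm δ x))
      (((‖e‖ ^ 2 : ℝ) : ℂ) * yukD κ (regNorm δ x) +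
        ((inner ℝ x e : ℝ) : ℂ) ^ 2 * yukDD κ (regNorm δ x)) x e := by
  have h1 : HasDerivAt (fun t : ℝ => yukD κ (regNorm δ (x + t • e))) _ 0 :=
    HasDerivAt.hasLineDerivAt_comp_regNorm hδ
      (hasDerivAt_yukD κ (hδ.trans_le (le_regNorm δ x)).ne') e
  have h2 : HasDerivAt (fun t : ℝ => inner ℝ (x + t • e) e) (‖e‖ ^ 2) 0 := by
    simp only [inner_add_left, real_inner_smul_left, real_inner_self_eq_norm_sq]
    simpa using ((hasDerivAt_id (0 : ℝ)).mul_const (‖e‖ ^ 2)).const_add (inner ℝ x e)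
  have h3 := h2.ofReal_comp.mul h1
  refine h3.congr_deriv ?_
  simp only [zero_smul, add_zero]
  ring

/-! ### Bounds -/

theorem exists_norm_poly_mul_exp_le {κ : ℂ} (hκ : 0 < κ.re) :
    ∃ C : ℝ, 0 < C ∧ ∀ s : ℝ, 0 ≤ s → ‖Complex.exp (-κ * s)‖ ≤ C ∧
      ‖(1 + κ * s) * Complex.exp (-κ * s)‖ ≤ C ∧
      ‖(3 + 3 * (κ * s) + (κ * s) ^ 2) * Complex.exp (-κ * s)‖ ≤ C := by
  set c := κ.re with hc
  set q := ‖κ‖ / c with hq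
  have hq0 : 0 ≤ q := by positivity
  -- With `p = c s`, `E = e^{-p}` and `‖κ s‖ = q p`, the bounds `E ≤ 1`, `p E ≤ 1`, `p² E ≤ 2`
  -- follow from `1 + p + p²/2 ≤ e^p`. The third polynomial is the largest and fixes the constant.
  refine ⟨3 + 3 * q + 2 * q ^ 2, by positivity, fun s hs => ?_⟩
  have he : ‖Complex.exp (-κ * s)‖ = Real.exp (-(c * s)) := by
    rw [Complex.norm_exp]; simp [hc]
  have hcs : 0 ≤ c * s := by positivity
  have h1 : (1 + c * s + (c * s) ^ 2 / 2) * Real.exp (-(c * s)) ≤ 1 := by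
    rw [Real.exp_neg, mul_inv_le_iff₀ (Real.exp_pos _), one_mul]
    exact Real.quadratic_le_exp_of_nonneg hcs
  have hκs : ‖κ * s‖ = q * (c * s) := by
    rw [norm_mul, Complex.norm_real, Real.norm_of_nonneg hs, hq]; field_simp
  set E := Real.exp (-(c * s)) with hE
  have hE0 : 0 < E := Real.exp_pos _
  set p := c * s with hp
  have hp1 : 0 ≤ p * E := by positivity
  have hp2 : 0 ≤ p ^ 2 * E := by positivity
  have e1 : E ≤ 1 := by nlinarith
  have e2 : p * E ≤ 1 := by nlinarith
  have e3 : p ^ 2 * E ≤ 2 := by nlinarith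
  refine ⟨?_, ?_, ?_⟩
  · rw [he]; nlinarith [sq_nonneg q]
  · rw [norm_mul, he]
    have : ‖1 + κ * s‖ ≤ 1 + q * p := by
      refine (norm_add_le _ _).trans ?_
      rw [hκs, norm_one]
    refine (mul_le_mul_of_nonneg_right this hE0.le).trans ?_
    nlinarith [sq_nonneg q, mul_le_mul_of_nonneg_left e2 hq0]
  · rw [norm_mul, he]
    have : ‖3 + 3 * (κ * s) + (κ * s) ^ 2‖ ≤ 3 + 3 * (q * p) + (q * p) ^ 2 := by
      refine (norm_add_le _ _).trans ?_
      rw [norm_pow, hκs]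
      gcongr
      refine (norm_add_le _ _).trans ?_
      rw [norm_mul, hκs]
      simp
    refine (mul_le_mul_of_nonneg_right this hE0.le).trans ?_
    nlinarith [sq_nonneg q, mul_le_mul_of_nonneg_left e2 hq0,
      mul_le_mul_of_nonneg_left e3 (sq_nonneg q)]

theorem exists_norm_yuk_le {κ : ℂ} (hκ : 0 < κ.re) :
    ∃ C : ℝ, 0 < C ∧ ∀ s : ℝ, 0 ≤ s → ‖yuk κ s‖ ≤ C / s ∧ ‖yukD κ s‖ ≤ C / s ^ 3 ∧
      ‖yukDD κ s‖ ≤ C / s ^ 5 := by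
  obtain ⟨C, hC, h⟩ := exists_norm_poly_mul_exp_le hκ
  refine ⟨C, hC, fun s hs => ?_⟩
  obtain ⟨h1, h2, h3⟩ := h s hs
  have hπ : 1 ≤ 4 * Real.pi := by linarith [Real.pi_gt_three]
  have key (z : ℂ) (hz : ‖z‖ ≤ C) (n : ℕ) : ‖z / (4 * Real.pi * s ^ n)‖ ≤ C / s ^ n := by
    rw [norm_div, norm_mul, norm_mul, norm_pow, Complex.norm_real, Complex.norm_real,
      Real.norm_of_nonneg hs, Real.norm_of_nonneg Real.pi_pos.le, Complex.norm_ofNat]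
    rcases hs.eq_or_lt with rfl | hs
    · rcases n with _ | n
      · simpa using (div_le_self (norm_nonneg z) hπ).trans hz
      · simp
    · have : 0 < s ^ n := by positivity
      gcongr
      exact le_mul_of_one_le_left this.le hπ
  refine ⟨by simpa [yuk] using key _ h1 1, ?_, key _ h3 5⟩
  exact key _ (by rwa [norm_neg]) 3

theorem continuousOn_yuk (κ : ℂ) : ContinuousOn (yuk κ) (Ioi 0) := fun _ hs =>
  (hasDerivAt_yuk κ (ne_of_gt hs)).continuousAt.continuousWithinAt

theorem continuousOn_yukD (κ : ℂ) : ContinuousOn (yukD κ) (Ioi 0) := fun _ hs =>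
  (hasDerivAt_yukD κ (ne_of_gt hs)).continuousAt.continuousWithinAt

theorem continuousOn_yukDD (κ : ℂ) : ContinuousOn (yukDD κ) (Ioi 0) := by
  unfold yukDD
  refine ContinuousOn.div (by fun_prop) (by fun_prop) fun s hs => ?_
  have hs' : (s : ℂ) ≠ 0 := Complex.ofReal_ne_zero.2 (ne_of_gt hs)
  have hπ : (Real.pi : ℂ) ≠ 0 := Complex.ofReal_ne_zero.2 Real.pi_ne_zero
  simp [hs', hπ]

theorem _root_.ContinuousOn.comp_regNorm {g : ℝ → ℂ} (hg : ContinuousOn g (Ioi 0)) {δ : ℝ} (hδ : 0 < δ) :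
    Continuous fun x => g (regNorm δ x) :=
  hg.comp_continuous (continuous_regNorm δ) fun x => hδ.trans_le (le_regNorm δ x)

/-! ### Integration by parts against Schwartz functions -/

theorem integrable_smul_schwartz {p : Space → ℂ} (hp : Continuous p) {C : ℝ}
    (hC : ∀ x, ‖p x‖ ≤ C) (f : 𝓢(Space, Spinor)) (x : Space) :
    Integrable fun y => p (x - y) • f y :=
  f.integrable.bdd_smul C (by fun_prop) (ae_of_all _ fun y => hC _)

/-- The kernel is differentiated in `y` through `x - y`, and the resulting sign cancels the sign of
integration by parts. -/
theorem integral_smul_lineDeriv_schwartz {p p' : Space → ℂ} {e : Space} (hp : Continuous p)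
    (hp' : Continuous p') {C C' : ℝ} (hC : ∀ x, ‖p x‖ ≤ C) (hC' : ∀ x, ‖p' x‖ ≤ C')
    (hpp' : ∀ x, HasLineDerivAt ℝ p (p' x) x e) (f : 𝓢(Space, Spinor)) (x : Space) :
    ∫ y, p (x - y) • (∂_{e} f : 𝓢(Space, Spinor)) y = ∫ y, p' (x - y) • f y := by
  have h1 (y : Space) : HasLineDerivAt ℝ (fun y => p (x - y)) (-p' (x - y)) y e := by
    have h2 : HasDerivAt (fun t : ℝ => p (x - y + t • e)) (p' (x - y)) (-0) := by
      rw [neg_zero]; exact hpp' (x - y)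
    have h3 := h2.scomp (0 : ℝ) (hasDerivAt_neg (0 : ℝ))
    have h5 : (fun t : ℝ => p (x - (y + t • e))) = (fun t : ℝ => p (x - y + t • e)) ∘ Neg.neg := by
      ext t
      simp only [Function.comp_apply]
      congr 1
      rw [neg_smul]; abel
    unfold HasLineDerivAt
    rw [h5]
    exact h3.congr_deriv (by simp)
  have h4 := integral_bilinear_hasLineDerivAt_right_eq_neg_left_of_integrable (μ := volume)
    (f := fun y => p (x - y)) (f' := fun y => -p' (x - y)) (g := f) (g' := fun y => (∂_{e} f : 𝓢(Space, Spinor)) y) (v := e)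
    (B := ContinuousLinearMap.lsmul ℝ ℂ) ?_ ?_ ?_ (fun y _ => h1 y) (fun y _ => ?_)
  · simp only [ContinuousLinearMap.lsmul_apply, neg_smul, integral_neg, neg_neg] at h4
    exact h4
  · have h5 := (integrable_smul_schwartz hp' hC' f x).neg
    simp only [Pi.neg_def, ← neg_smul] at h5
    exact h5
  · exact integrable_smul_schwartz hp hC (∂_{e} f : 𝓢(Space, Spinor)) x
  · exact integrable_smul_schwartz hp hC f x
  · have := (f.differentiableAt (x := y)).hasFDerivAt.hasLineDerivAt e
    rwa [← SchwartzMap.lineDerivOp_apply_eq_fderiv] at this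

/-! ### Integrability of the singular kernels -/

/-- The function `|z|⁻²`, cut off outside the unit ball. -/
def invSqCut (z : Space) : ℝ := (Iio (1 : ℝ)).indicator (fun r => (r ^ 2)⁻¹) ‖z‖

theorem integrable_invSqCut : Integrable invSqCut := by
  unfold invSqCut
  rw [integrable_fun_norm_addHaar volume (f := (Iio (1 : ℝ)).indicator fun r => (r ^ 2)⁻¹)]
  have h : IntegrableOn ((Iio (1 : ℝ)).indicator fun _ => (1 : ℝ)) (Ioi 0) := by
    rw [integrableOn_indicator_iff measurableSet_Iio]
    exact integrableOn_const (by simp [Iio_inter_Ioi])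
  refine h.congr_fun (fun r hr => ?_) measurableSet_Ioi
  have hr' : r ≠ 0 := ne_of_gt hr
  by_cases h1 : r < 1 <;> simp [indicator, h1, hr']

theorem invSqCut_nonneg (z : Space) : 0 ≤ invSqCut z :=
  indicator_nonneg (fun r _ => by positivity) _

/-- A single majorant for singularities of order at most two: an integrable part near the origin,
plus a constant to be absorbed by the integrability of a Schwartz function. -/
theorem inv_norm_pow_le (z : Space) {k : ℕ} (hk : k ≤ 2) : (‖z‖ ^ k)⁻¹ ≤ invSqCut z + 1 := by
  rcases eq_or_ne z 0 with rfl | hz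
  · rcases k with _ | k
    · simp [invSqCut]
    · simpa using add_nonneg (invSqCut_nonneg 0) zero_le_one
  have hz' : 0 < ‖z‖ := norm_pos_iff.2 hz
  by_cases h1 : ‖z‖ < 1
  · have : (‖z‖ ^ k)⁻¹ ≤ (‖z‖ ^ 2)⁻¹ :=
      inv_anti₀ (by positivity) (pow_le_pow_of_le_one hz'.le h1.le hk)
    simp only [invSqCut, indicator, mem_Iio, h1, if_true]
    linarith
  · have : (‖z‖ ^ k)⁻¹ ≤ 1 := inv_le_one_of_one_le₀ (one_le_pow₀ (not_lt.1 h1))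
    linarith [invSqCut_nonneg z]

theorem integrable_invSqCut_mul_schwartz (f : 𝓢(Space, Spinor)) (x : Space) (C : ℝ) :
    Integrable fun y => C * (invSqCut (x - y) + 1) * ‖f y‖ := by
  have h1 : Integrable fun y => invSqCut (x - y) * ‖f y‖ :=
    (integrable_invSqCut.comp_sub_left x).mul_bdd (c := SchwartzMap.seminorm ℝ 0 0 f)
      f.continuous.norm.aestronglyMeasurable
      (ae_of_all _ fun y => by simpa using SchwartzMap.norm_le_seminorm ℝ f y)
  have h2 := (h1.add f.integrable.norm).const_mul C
  refine h2.congr (ae_of_all _ fun y => ?_)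
  simp only [Pi.add_apply]; ring

theorem ae_sub_ne_zero (x : Space) : ∀ᵐ y : Space, x - y ≠ 0 := by
  filter_upwards [compl_mem_ae_iff.2 (measure_singleton (μ := (volume : Measure Space)) x)]
    with y hy h
  exact hy (by simpa using (sub_eq_zero.1 h).symm)

/-- Dominated convergence: the bound is uniform in `δ`, and a singularity of order at most two is
integrable in dimension three. The point `y = x`, where no bound is available, is a null set. -/
theorem tendsto_integral_regNorm {p : ℝ → Space → ℂ} {C : ℝ} {k : ℕ} (hk : k ≤ 2)
    (hp : ∀ δ > 0, Continuous (p δ)) (hC : 0 ≤ C)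
    (hb : ∀ δ > 0, ∀ z ≠ 0, ‖p δ z‖ ≤ C / ‖z‖ ^ k)
    (hlim : ∀ z ≠ 0, Tendsto (fun δ => p δ z) (𝓝[>] 0) (𝓝 (p 0 z)))
    (f : 𝓢(Space, Spinor)) (x : Space) :
    Tendsto (fun δ => ∫ y, p δ (x - y) • f y) (𝓝[>] 0) (𝓝 (∫ y, p 0 (x - y) • f y)) := by
  refine tendsto_integral_filter_of_dominated_convergence
    (fun y => C * (invSqCut (x - y) + 1) * ‖f y‖) ?_ ?_
    (integrable_invSqCut_mul_schwartz f x C) ?_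
  · filter_upwards [self_mem_nhdsWithin] with δ hδ
    have := hp δ hδ
    have hf := f.continuous
    exact Continuous.aestronglyMeasurable (by fun_prop)
  · filter_upwards [self_mem_nhdsWithin] with δ hδ
    filter_upwards [ae_sub_ne_zero x] with y hy
    rw [norm_smul]
    gcongr
    refine (hb δ hδ _ hy).trans ?_
    rw [div_eq_mul_inv]
    exact mul_le_mul_of_nonneg_left (inv_norm_pow_le _ hk) hC
  · filter_upwards [ae_sub_ne_zero x] with y hy
    exact (hlim _ hy).smul_const _

theorem _root_.ContinuousOn.tendsto_regNorm {g : ℝ → ℂ} (hg : ContinuousOn g (Ioi 0)) {z : Space}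
    (hz : z ≠ 0) : Tendsto (fun δ => g (regNorm δ z)) (𝓝[>] 0) (𝓝 (g (regNorm 0 z))) := by
  have h0 : 0 < regNorm 0 z := by rw [regNorm_zero_left]; exact norm_pos_iff.2 hz
  have h1 : Tendsto (fun δ => regNorm δ z) (𝓝[>] 0) (𝓝 (regNorm 0 z)) :=
    ((continuous_regNorm_left z).tendsto 0).mono_left nhdsWithin_le_nhds
  exact (hg.continuousAt (Ioi_mem_nhds h0)).tendsto.comp h1

section Limits

variable {κ : ℂ} (hκ : 0 < κ.re)
include hκ

theorem tendsto_integral_yuk (f : 𝓢(Space, Spinor)) (x : Space) :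
    Tendsto (fun δ => ∫ y, yuk κ (regNorm δ (x - y)) • f y) (𝓝[>] 0)
      (𝓝 (∫ y, yuk κ (regNorm 0 (x - y)) • f y)) := by
  obtain ⟨C, hC, h⟩ := exists_norm_yuk_le hκ
  refine tendsto_integral_regNorm (p := fun δ z => yuk κ (regNorm δ z)) (C := C) (k := 1)
    (by norm_num) (fun δ hδ => (continuousOn_yuk κ).comp_regNorm hδ) hC.le
    (fun δ hδ z hz => ?_) (fun z hz => (continuousOn_yuk κ).tendsto_regNorm hz) f x
  have hz' : 0 < ‖z‖ := norm_pos_iff.2 hz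
  refine (h _ (hz'.le.trans (norm_le_regNorm δ z))).1.trans ?_
  rw [pow_one]
  exact div_le_div_of_nonneg_left hC.le hz' (norm_le_regNorm δ z)

theorem tendsto_integral_inner_mul_yukD (e : Space) (f : 𝓢(Space, Spinor)) (x : Space) :
    Tendsto (fun δ => ∫ y, (((inner ℝ (x - y) e : ℝ) : ℂ) * yukD κ (regNorm δ (x - y))) • f y)
      (𝓝[>] 0)
      (𝓝 (∫ y, (((inner ℝ (x - y) e : ℝ) : ℂ) * yukD κ (regNorm 0 (x - y))) • f y)) := by
  obtain ⟨C, hC, h⟩ := exists_norm_yuk_le hκ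
  refine tendsto_integral_regNorm (k := 2) (C := ‖e‖ * C)
    (p := fun δ z => ((inner ℝ z e : ℝ) : ℂ) * yukD κ (regNorm δ z)) le_rfl
    (fun δ hδ => ?_) (by positivity) (fun δ hδ z hz => ?_)
    (fun z hz => ((continuousOn_yukD κ).tendsto_regNorm hz).const_mul _) f x
  · have := (continuousOn_yukD κ).comp_regNorm hδ
    fun_prop
  · have hz' : 0 < ‖z‖ := norm_pos_iff.2 hz
    have hs := norm_le_regNorm δ z
    rw [norm_mul, Complex.norm_real, Real.norm_eq_abs]
    have h1 := abs_real_inner_le_norm z e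
    have h2 := (h _ (hz'.le.trans hs)).2.1
    have h3 : C / regNorm δ z ^ 3 ≤ C / ‖z‖ ^ 3 :=
      div_le_div_of_nonneg_left hC.le (by positivity) (by gcongr)
    refine (mul_le_mul h1 (h2.trans h3) (norm_nonneg _) (by positivity)).trans_eq ?_
    field_simp

theorem exists_bound_yuk_regNorm {δ : ℝ} (hδ : 0 < δ) (e : Space) : ∃ C : ℝ, ∀ z : Space,
    ‖yuk κ (regNorm δ z)‖ ≤ C ∧ ‖((inner ℝ z e : ℝ) : ℂ) * yukD κ (regNorm δ z)‖ ≤ C ∧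
      ‖((‖e‖ ^ 2 : ℝ) : ℂ) * yukD κ (regNorm δ z) +
        ((inner ℝ z e : ℝ) : ℂ) ^ 2 * yukDD κ (regNorm δ z)‖ ≤ C ∧
      ‖yukDD κ (regNorm δ z)‖ ≤ C := by
  obtain ⟨C, hC, h⟩ := exists_norm_yuk_le hκ
  -- The sum of the separate bounds, so that one constant serves all four estimates; each uses `δ ≤
  -- s` and `|⟨z, e⟩| ≤ s ‖e‖`.
  refine ⟨C / δ + ‖e‖ * (C / δ ^ 2) + (‖e‖ ^ 2 * (C / δ ^ 3) + ‖e‖ ^ 2 * (C / δ ^ 3)) + C / δ ^ 5,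
    fun z => ?_⟩
  set s := regNorm δ z with hs
  have hsδ : δ ≤ s := le_regNorm δ z
  have hs0 : 0 < s := hδ.trans_le hsδ
  have hin : |inner ℝ z e| ≤ s * ‖e‖ := (abs_real_inner_le_norm z e).trans
    (mul_le_mul_of_nonneg_right (norm_le_regNorm δ z) (norm_nonneg e))
  obtain ⟨h1, h2, h3⟩ := h s hs0.le
  have hd (n : ℕ) : C / s ^ n ≤ C / δ ^ n :=
    div_le_div_of_nonneg_left hC.le (by positivity) (by gcongr)
  have hp (n : ℕ) : 0 ≤ C / δ ^ n := by positivity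
  have b1 : ‖yuk κ s‖ ≤ C / δ := by simpa using h1.trans (by simpa using hd 1)
  have b2 : ‖((inner ℝ z e : ℝ) : ℂ) * yukD κ s‖ ≤ ‖e‖ * (C / δ ^ 2) := by
    rw [norm_mul, Complex.norm_real, Real.norm_eq_abs]
    refine (mul_le_mul hin h2 (norm_nonneg _) (by positivity)).trans ?_
    have : s * ‖e‖ * (C / s ^ 3) = ‖e‖ * (C / s ^ 2) := by field_simp
    rw [this]
    exact mul_le_mul_of_nonneg_left (hd 2) (norm_nonneg e)
  have b3 : ‖((‖e‖ ^ 2 : ℝ) : ℂ) * yukD κ s‖ ≤ ‖e‖ ^ 2 * (C / δ ^ 3) := by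
    rw [norm_mul, Complex.norm_real, Real.norm_of_nonneg (by positivity)]
    exact mul_le_mul_of_nonneg_left (h2.trans (hd 3)) (by positivity)
  have b4 : ‖((inner ℝ z e : ℝ) : ℂ) ^ 2 * yukDD κ s‖ ≤ ‖e‖ ^ 2 * (C / δ ^ 3) := by
    rw [norm_mul, norm_pow, Complex.norm_real, Real.norm_eq_abs]
    refine (mul_le_mul (pow_le_pow_left₀ (abs_nonneg _) hin 2) h3 (norm_nonneg _)
      (by positivity)).trans ?_
    have : (s * ‖e‖) ^ 2 * (C / s ^ 5) = ‖e‖ ^ 2 * (C / s ^ 3) := by field_simp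
    rw [this]
    exact mul_le_mul_of_nonneg_left (hd 3) (by positivity)
  have b5 := h3.trans (hd 5)
  have p1 : 0 ≤ C / δ := by positivity
  have p2 : 0 ≤ ‖e‖ * (C / δ ^ 2) := by positivity
  have p3 : 0 ≤ ‖e‖ ^ 2 * (C / δ ^ 3) := by positivity
  have p5 := hp 5
  refine ⟨by linarith, by linarith, (norm_add_le _ _).trans (by linarith), by linarith⟩

theorem integral_yuk_regNorm_smul_lineDeriv {δ : ℝ} (hδ : 0 < δ) (e : Space)
    (f : 𝓢(Space, Spinor)) (x : Space) :
    ∫ y, yuk κ (regNorm δ (x - y)) • (∂_{e} f : 𝓢(Space, Spinor)) y =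
      ∫ y, (((inner ℝ (x - y) e : ℝ) : ℂ) * yukD κ (regNorm δ (x - y))) • f y := by
  obtain ⟨C, h⟩ := exists_bound_yuk_regNorm hκ hδ e
  have h1 := (continuousOn_yukD κ).comp_regNorm hδ
  exact integral_smul_lineDeriv_schwartz
    (p' := fun z => ((inner ℝ z e : ℝ) : ℂ) * yukD κ (regNorm δ z))
    ((continuousOn_yuk κ).comp_regNorm hδ) (by fun_prop) (fun z => (h z).1)
    (fun z => (h z).2.1) (fun z => hasLineDerivAt_yuk_regNorm κ hδ z e) f x

theorem integral_yuk_regNorm_smul_lineDeriv_lineDeriv {δ : ℝ} (hδ : 0 < δ) (e : Space)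
    (f : 𝓢(Space, Spinor)) (x : Space) :
    ∫ y, yuk κ (regNorm δ (x - y)) • (∂_{e} (∂_{e} f : 𝓢(Space, Spinor)) : 𝓢(Space, Spinor)) y =
      ∫ y, (((‖e‖ ^ 2 : ℝ) : ℂ) * yukD κ (regNorm δ (x - y)) +
        ((inner ℝ (x - y) e : ℝ) : ℂ) ^ 2 * yukDD κ (regNorm δ (x - y))) • f y := by
  obtain ⟨C, h⟩ := exists_bound_yuk_regNorm hκ hδ e
  have h1 := (continuousOn_yukD κ).comp_regNorm hδ
  have h2 := (continuousOn_yukDD κ).comp_regNorm hδ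
  rw [integral_yuk_regNorm_smul_lineDeriv hκ hδ]
  exact integral_smul_lineDeriv_schwartz
    (p := fun z => ((inner ℝ z e : ℝ) : ℂ) * yukD κ (regNorm δ z))
    (p' := fun z => ((‖e‖ ^ 2 : ℝ) : ℂ) * yukD κ (regNorm δ z) +
      ((inner ℝ z e : ℝ) : ℂ) ^ 2 * yukDD κ (regNorm δ z)) (by fun_prop) (by fun_prop)
    (fun z => (h z).2.1) (fun z => (h z).2.2.1)
    (fun z => hasLineDerivAt_inner_mul_yukD_regNorm κ hδ z e) f x

/-- The gradient of the Yukawa potential may be moved to a Schwartz function. -/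
theorem integral_yuk_smul_lineDeriv (e : Space) (f : 𝓢(Space, Spinor)) (x : Space) :
    ∫ y, yuk κ ‖x - y‖ • (∂_{e} f : 𝓢(Space, Spinor)) y =
      ∫ y, (((inner ℝ (x - y) e : ℝ) : ℂ) * yukD κ ‖x - y‖) • f y := by
  have h1 := tendsto_integral_yuk hκ (∂_{e} f : 𝓢(Space, Spinor)) x
  have h2 := tendsto_integral_inner_mul_yukD hκ e f x
  simp only [regNorm_zero_left] at h1 h2
  refine tendsto_nhds_unique h1 (h2.congr' ?_)
  filter_upwards [self_mem_nhdsWithin] with δ hδ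
  exact (integral_yuk_regNorm_smul_lineDeriv hκ hδ e f x).symm

end Limits

/-! ### The fundamental solution of `κ² - Δ` -/

open Laplacian

theorem inner_basisVec (z : Space) (j : Fin 3) : inner ℝ z (basisVec j) = z j := by
  simp [basisVec, EuclideanSpace.inner_single_right]

/-- The radial Helmholtz equation: in dimension three the Laplacian of a radial `g` is `3 (g'/s) +
s² ((g'/s)'/s)`. -/
theorem yuk_ode (κ : ℂ) {s : ℝ} (hs : 0 < s) :
    κ ^ 2 * yuk κ s - 3 * yukD κ s - (s : ℂ) ^ 2 * yukDD κ s = 0 := by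
  have hs' : (s : ℂ) ≠ 0 := Complex.ofReal_ne_zero.2 hs.ne'
  have hπ : (Real.pi : ℂ) ≠ 0 := Complex.ofReal_ne_zero.2 Real.pi_ne_zero
  rw [yuk, yukD, yukDD]
  field_simp
  ring

/-- An explicit primitive for the radial mass integral: `r / √(r² + 1)` has derivative `(r² +
1)^(-3/2)`, so its cube has derivative `3 r² (r² + 1)^(-5/2)`. -/
theorem sq_add_one_sqrt_deriv (r : ℝ) :
    HasDerivAt (fun r : ℝ => (4 * Real.pi)⁻¹ * (r / Real.sqrt (r ^ 2 + 1)) ^ 3)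
      (r ^ 2 * (3 / (4 * Real.pi * Real.sqrt (r ^ 2 + 1) ^ 5))) r := by
  have h0 : 0 < r ^ 2 + 1 := by positivity
  have h1 : HasDerivAt (fun r : ℝ => r ^ 2 + 1) (2 * r) r := by
    simpa using ((hasDerivAt_id r).pow 2).add_const 1
  have h2 := h1.sqrt h0.ne'
  have h3 := (((hasDerivAt_id r).div h2 (Real.sqrt_pos.2 h0).ne').pow 3).const_mul
    (4 * Real.pi)⁻¹
  refine h3.congr_deriv ?_
  have hs : 0 < Real.sqrt (r ^ 2 + 1) := Real.sqrt_pos.2 h0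
  have hsq : Real.sqrt (r ^ 2 + 1) ^ 2 = r ^ 2 + 1 := Real.sq_sqrt h0.le
  have hπ := Real.pi_ne_zero
  simp only [id, Pi.div_apply]
  set s := Real.sqrt (r ^ 2 + 1)
  have e : (1 * s - r * (2 * r / (2 * s))) / s ^ 2 = 1 / s ^ 3 := by
    field_simp
    linarith
  rw [e]
  simp only [Nat.cast_ofNat, Nat.add_one_sub_one]
  field_simp

theorem tendsto_div_sqrt_sq_add_one :
    Tendsto (fun r : ℝ => (4 * Real.pi)⁻¹ * (r / Real.sqrt (r ^ 2 + 1)) ^ 3) atTop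
      (𝓝 (4 * Real.pi)⁻¹) := by
  have h1 : Tendsto (fun r : ℝ => r ^ 2 + 1) atTop atTop :=
    tendsto_atTop_add_const_right _ _ (tendsto_pow_atTop two_ne_zero)
  have h2 : Tendsto (fun r : ℝ => Real.sqrt (1 - (r ^ 2 + 1)⁻¹)) atTop (𝓝 1) := by
    have := (Real.continuous_sqrt.tendsto _).comp ((tendsto_const_nhds (x := (1 : ℝ))).sub
      (tendsto_inv_atTop_zero.comp h1))
    simpa [Function.comp_def] using this
  have h3 : Tendsto (fun r : ℝ => r / Real.sqrt (r ^ 2 + 1)) atTop (𝓝 1) := by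
    refine h2.congr' ?_
    filter_upwards [eventually_ge_atTop 0] with r hr
    have h0 : 0 < r ^ 2 + 1 := by positivity
    have : 1 - (r ^ 2 + 1)⁻¹ = r ^ 2 / (r ^ 2 + 1) := by field_simp; ring
    rw [this, Real.sqrt_div (by positivity), Real.sqrt_sq hr]
  simpa using (h3.pow 3).const_mul (4 * Real.pi)⁻¹

/-- In polar coordinates the radial integral is `(4π)⁻¹` and the unit sphere has area `3 · (4π/3) =
4π`. This normalisation is what gives the limiting delta function coefficient one. -/
theorem integral_regNorm_one :
    ∫ w : Space, 3 / (4 * Real.pi * regNorm 1 w ^ 5) = 1 := by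
  have h := integral_fun_norm_addHaar (volume : Measure Space)
    (fun r : ℝ => 3 / (4 * Real.pi * Real.sqrt (r ^ 2 + 1) ^ 5))
  have h1 : ∫ r in Ioi (0 : ℝ), r ^ 2 * (3 / (4 * Real.pi * Real.sqrt (r ^ 2 + 1) ^ 5))
      = (4 * Real.pi)⁻¹ := by
    rw [integral_Ioi_of_hasDerivAt_of_nonneg' (fun r _ => sq_add_one_sqrt_deriv r)
      (fun r _ => by positivity) tendsto_div_sqrt_sq_add_one]
    simp
  have h2 : (volume : Measure Space).real (Metric.ball 0 1) = Real.pi * 4 / 3 := by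
    rw [measureReal_def, EuclideanSpace.volume_ball_fin_three]
    simp [ENNReal.toReal_ofReal (show (0 : ℝ) ≤ Real.pi * 4 / 3 by positivity)]
  simp only [finrank_euclideanSpace, Fintype.card_fin, smul_eq_mul, h2, h1, nsmul_eq_mul,
    Nat.add_one_sub_one] at h
  have h3 : ∀ w : Space, regNorm 1 w = Real.sqrt (‖w‖ ^ 2 + 1) := fun w => by simp [regNorm]
  simp only [h3, h]
  have hπ := Real.pi_ne_zero
  field_simp
  norm_num

theorem integrable_regNorm_one : Integrable fun w : Space => (regNorm 1 w ^ 5)⁻¹ := by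
  have h := integrable_rpow_neg_one_add_norm_sq (E := Space) (μ := volume) (r := 5)
    (by simp; norm_num)
  refine h.congr (ae_of_all _ fun w => ?_)
  have h0 : (0 : ℝ) ≤ 1 + ‖w‖ ^ 2 := by positivity
  simp only [regNorm]
  rw [one_pow, add_comm (‖w‖ ^ 2), neg_div, Real.rpow_neg h0, Real.sqrt_eq_rpow,
    ← Real.rpow_natCast ((1 + ‖w‖ ^ 2) ^ (1 / 2 : ℝ)) 5, ← Real.rpow_mul h0]
  norm_num

section FundamentalSolution

variable {κ : ℂ} (hκ : 0 < κ.re)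
include hκ

/-- After two integrations by parts the kernel is `κ² yuk - 3 yukD - |z|² yukDD` at `s = regNorm δ
z`. Since `|z|² = s² - δ²`, the radial equation cancels everything except `δ² yukDD`. -/
theorem integral_yuk_regNorm_smul_helmholtz {δ : ℝ} (hδ : 0 < δ) (f : 𝓢(Space, Spinor))
    (x : Space) :
    ∫ y, yuk κ (regNorm δ (x - y)) • (κ ^ 2 • f - Δ f) y =
      ∫ y, ((δ ^ 2 : ℝ) * yukDD κ (regNorm δ (x - y))) • f y := by
  have hint : ∀ g : 𝓢(Space, Spinor), Integrable fun y => yuk κ (regNorm δ (x - y)) • g y := by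
    obtain ⟨C, h⟩ := exists_bound_yuk_regNorm hκ hδ 0
    exact fun g => integrable_smul_schwartz ((continuousOn_yuk κ).comp_regNorm hδ)
      (fun z => (h z).1) g x
  have hint1 : Integrable fun y => κ ^ 2 • yuk κ (regNorm δ (x - y)) • f y := by
    have := (hint f).smul (κ ^ 2)
    exact this
  have hint2 : ∀ j : Fin 3, Integrable fun y => (((‖basisVec j‖ ^ 2 : ℝ) : ℂ) *
      yukD κ (regNorm δ (x - y)) + ((inner ℝ (x - y) (basisVec j) : ℝ) : ℂ) ^ 2 *
        yukDD κ (regNorm δ (x - y))) • f y := by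
    intro j
    obtain ⟨C, h⟩ := exists_bound_yuk_regNorm hκ hδ (basisVec j)
    have h1 := (continuousOn_yukD κ).comp_regNorm hδ
    have h2 := (continuousOn_yukDD κ).comp_regNorm hδ
    exact integrable_smul_schwartz (p := fun z => ((‖basisVec j‖ ^ 2 : ℝ) : ℂ) *
      yukD κ (regNorm δ z) + ((inner ℝ z (basisVec j) : ℝ) : ℂ) ^ 2 *
        yukDD κ (regNorm δ z)) (by fun_prop) (fun z => (h z).2.2.1) f x
  have hΔ (y : Space) : (κ ^ 2 • f - Δ f) y = κ ^ 2 • f y - ∑ j : Fin 3,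
      (∂_{basisVec j} (∂_{basisVec j} f : 𝓢(Space, Spinor)) : 𝓢(Space, Spinor)) y := by
    rw [SchwartzMap.laplacian_eq_sum (EuclideanSpace.basisFun (Fin 3) ℝ)]
    simp [basisVec]
  have hsum : ∫ y, yuk κ (regNorm δ (x - y)) • (κ ^ 2 • f - Δ f) y =
      κ ^ 2 • (∫ y, yuk κ (regNorm δ (x - y)) • f y) - ∑ j : Fin 3,
        ∫ y, yuk κ (regNorm δ (x - y)) •
          (∂_{basisVec j} (∂_{basisVec j} f : 𝓢(Space, Spinor)) : 𝓢(Space, Spinor)) y := by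
    rw [← integral_finsetSum _ fun j _ => hint _, ← integral_smul,
      ← integral_sub hint1 (integrable_finsetSum _ fun j _ => hint _)]
    refine integral_congr_ae (ae_of_all _ fun y => ?_)
    simp only [hΔ, smul_sub, Finset.smul_sum]
    rw [smul_comm]
  rw [hsum]
  simp only [integral_yuk_regNorm_smul_lineDeriv_lineDeriv hκ hδ]
  rw [← integral_finsetSum _ fun j _ => hint2 j, ← integral_smul,
    ← integral_sub hint1 (integrable_finsetSum _ fun j _ => hint2 j)]
  refine integral_congr_ae (ae_of_all _ fun y => ?_)
  simp only
  rw [← Finset.sum_smul, smul_smul, ← sub_smul]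
  congr 1
  set z := x - y
  have hn : (∑ j : Fin 3, ((inner ℝ z (basisVec j) : ℝ) : ℂ) ^ 2) = ((‖z‖ ^ 2 : ℝ) : ℂ) := by
    rw [EuclideanSpace.real_norm_sq_eq]
    simp [inner_basisVec]
  have hs : ((‖z‖ ^ 2 : ℝ) : ℂ) = (regNorm δ z : ℂ) ^ 2 - ((δ ^ 2 : ℝ) : ℂ) := by
    rw [eq_sub_iff_add_eq, ← Complex.ofReal_add, ← regNorm_sq, Complex.ofReal_pow]
  have hb (j : Fin 3) : ‖basisVec j‖ = 1 := by simp [basisVec]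
  rw [Finset.sum_add_distrib, ← Finset.sum_mul, ← Finset.sum_mul, hn, hs]
  simp only [hb, Fin.sum_univ_three]
  have := yuk_ode κ (hδ.trans_le (le_regNorm δ z))
  push_cast
  linear_combination this

/-- The kernel is an approximate identity at scale `δ`. After rescaling it becomes `P(δ s) / (4π
s⁵)` with `s = regNorm 1 w`, which tends to `3 / (4π s⁵)`, of total mass one. -/
theorem tendsto_integral_yukDD (f : 𝓢(Space, Spinor)) (x : Space) :
    Tendsto (fun δ : ℝ => ∫ y, ((δ ^ 2 : ℝ) * yukDD κ (regNorm δ (x - y))) • f y) (𝓝[>] 0)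
      (𝓝 (f x)) := by
  obtain ⟨P, hP⟩ : ∃ P : ℝ → ℂ,
    P = fun t : ℝ => (3 + 3 * (κ * t) + (κ * t) ^ 2) * Complex.exp (-κ * t) := ⟨_, rfl⟩
  have hPc : Continuous P := by rw [hP]; fun_prop
  obtain ⟨C, hC, hb⟩ := exists_norm_poly_mul_exp_le hκ
  have hs0 (w : Space) : 0 < regNorm 1 w := one_pos.trans_le (le_regNorm 1 w)
  have hscale : ∀ δ > 0, ∀ w : Space, regNorm δ (δ • w) = δ * regNorm 1 w := by
    intro δ hδ w
    rw [regNorm, regNorm, norm_smul, Real.norm_of_nonneg hδ.le,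
      show (δ * ‖w‖) ^ 2 + δ ^ 2 = δ ^ 2 * (‖w‖ ^ 2 + 1 ^ 2) by ring,
      Real.sqrt_mul (by positivity), Real.sqrt_sq hδ.le]
  -- Substituting `y = x - δ w`, the prefactor `δ²` and the Jacobian `δ³` cancel the `δ⁵` in the
  -- denominator of `yukDD`.
  have hchange : ∀ δ > 0, ∫ y, ((δ ^ 2 : ℝ) * yukDD κ (regNorm δ (x - y))) • f y =
      ∫ w, (P (δ * regNorm 1 w) / (4 * Real.pi * (regNorm 1 w) ^ 5)) • f (x - δ • w) := by
    intro δ hδ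
    have h1 := integral_sub_left_eq_self
      (fun z => ((δ ^ 2 : ℝ) * yukDD κ (regNorm δ z)) • f (x - z)) volume x
    have h2 := Measure.integral_comp_smul (volume : Measure Space)
      (fun z => ((δ ^ 2 : ℝ) * yukDD κ (regNorm δ z)) • f (x - z)) δ
    simp only [sub_sub_cancel] at h1
    rw [h1]
    rw [finrank_euclideanSpace, Fintype.card_fin, abs_of_pos (by positivity),
      eq_inv_smul_iff₀ (by positivity)] at h2
    rw [← h2, ← integral_smul]
    refine integral_congr_ae (ae_of_all _ fun w => ?_)
    simp only [hscale δ hδ]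
    rw [← Complex.coe_smul (δ ^ 3), smul_smul]
    congr 1
    have hδ' : (δ : ℂ) ≠ 0 := Complex.ofReal_ne_zero.2 hδ.ne'
    have hw' : (regNorm 1 w : ℂ) ≠ 0 := Complex.ofReal_ne_zero.2 (hs0 w).ne'
    have hπ : (Real.pi : ℂ) ≠ 0 := Complex.ofReal_ne_zero.2 Real.pi_ne_zero
    rw [hP, yukDD]
    push_cast
    field_simp
  have hlim : Tendsto (fun δ : ℝ => ∫ w, (P (δ * regNorm 1 w) /
      (4 * Real.pi * (regNorm 1 w) ^ 5)) • f (x - δ • w)) (𝓝[>] 0)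
      (𝓝 (∫ w, ((3 / (4 * Real.pi * regNorm 1 w ^ 5) : ℝ) : ℂ) • f x)) := by
    refine tendsto_integral_filter_of_dominated_convergence
      (fun w => C * SchwartzMap.seminorm ℝ 0 0 f * (regNorm 1 w ^ 5)⁻¹) ?_ ?_
      (integrable_regNorm_one.const_mul _) ?_
    · refine Eventually.of_forall fun δ => Continuous.aestronglyMeasurable ?_
      have h1 := continuous_regNorm 1
      have h2 := f.continuous
      have h3 : Continuous fun w => P (δ * regNorm 1 w) := by fun_prop
      have h4 : Continuous fun w : Space => 4 * (Real.pi : ℂ) * (regNorm 1 w : ℂ) ^ 5 := by fun_prop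
      have h5 : Continuous fun w => f (x - δ • w) := by fun_prop
      refine (h3.div h4 fun w => ?_).smul h5
      have hw' : (regNorm 1 w : ℂ) ≠ 0 := Complex.ofReal_ne_zero.2 (hs0 w).ne'
      have hπ : (Real.pi : ℂ) ≠ 0 := Complex.ofReal_ne_zero.2 Real.pi_ne_zero
      simp [hw', hπ]
    · filter_upwards [self_mem_nhdsWithin] with δ hδ
      refine ae_of_all _ fun w => ?_
      have h1 : ‖P (δ * regNorm 1 w)‖ ≤ C := by
        rw [hP]
        exact (hb (δ * regNorm 1 w) (mul_pos hδ (hs0 w)).le).2.2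
      have h2 : ‖f (x - δ • w)‖ ≤ SchwartzMap.seminorm ℝ 0 0 f := by
        simpa using SchwartzMap.norm_le_seminorm ℝ f (x - δ • w)
      have hπ : 1 ≤ 4 * Real.pi := by linarith [Real.pi_gt_three]
      have h5 : 0 < regNorm 1 w ^ 5 := pow_pos (hs0 w) 5
      have h3 : ‖P (δ * regNorm 1 w) / (4 * Real.pi * (regNorm 1 w) ^ 5)‖ ≤
          C / regNorm 1 w ^ 5 := by
        rw [norm_div, norm_mul, norm_mul, norm_pow, Complex.norm_real, Complex.norm_real,
          Real.norm_of_nonneg (hs0 w).le, Real.norm_of_nonneg Real.pi_pos.le,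
          Complex.norm_ofNat]
        gcongr
        exact le_mul_of_one_le_left h5.le hπ
      rw [norm_smul]
      refine (mul_le_mul h3 h2 (norm_nonneg _) (by positivity)).trans_eq ?_
      rw [div_eq_mul_inv]; ring
    · refine ae_of_all _ fun w => ?_
      have h1 : Continuous fun δ : ℝ => (P (δ * regNorm 1 w) /
          (4 * Real.pi * (regNorm 1 w) ^ 5)) • f (x - δ • w) := by
        have h2 := f.continuous
        fun_prop
      refine ((h1.tendsto 0).mono_left nhdsWithin_le_nhds).congr' (Eventually.of_forall fun _ => rfl)
        |>.trans (le_of_eq ?_)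
      simp [hP]
  rw [integral_smul_const, integral_complex_ofReal, integral_regNorm_one, Complex.ofReal_one,
    one_smul] at hlim
  refine hlim.congr' ?_
  filter_upwards [self_mem_nhdsWithin] with δ hδ
  exact (hchange δ hδ).symm

/-- The Yukawa potential is the fundamental solution of `κ² - Δ`. -/
theorem integral_yuk_smul_helmholtz (f : 𝓢(Space, Spinor)) (x : Space) :
    ∫ y, yuk κ ‖x - y‖ • (κ ^ 2 • f - Δ f) y = f x := by
  have h1 := tendsto_integral_yuk hκ (κ ^ 2 • f - Δ f) x
  simp only [regNorm_zero_left] at h1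
  refine tendsto_nhds_unique h1 ((tendsto_integral_yukDD hκ f x).congr' ?_)
  filter_upwards [self_mem_nhdsWithin] with δ hδ
  exact (integral_yuk_regNorm_smul_helmholtz hκ hδ f x).symm

end FundamentalSolution

/-! ### The spectral parameter -/

/-- The number `m² - a²` can be real and nonpositive only for real `a` with `a² ≥ m²`. If `a` is
purely imaginary its real part is positive; for other nonreal `a` its imaginary part is nonzero. -/
theorem sq_sub_sq_mem_slitPlane {m : ℝ} {a : ℂ}
    (ha : a.im ≠ 0 ∨ (a.im = 0 ∧ -m < a.re ∧ a.re < m)) :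
    (m : ℂ) ^ 2 - a ^ 2 ∈ Complex.slitPlane := by
  have hre : ((m : ℂ) ^ 2 - a ^ 2).re = m ^ 2 - a.re ^ 2 + a.im ^ 2 := by
    simp [sq]; ring
  have him : ((m : ℂ) ^ 2 - a ^ 2).im = -(2 * a.re * a.im) := by
    simp [sq]; ring
  rw [Complex.mem_slitPlane_iff, hre, him]
  rcases ha with h | ⟨h, h1, h2⟩
  · by_cases h0 : a.re = 0
    · left
      rw [h0]
      have := pow_pos (abs_pos.2 h) 2
      rw [sq_abs] at this
      nlinarith [sq_nonneg m]
    · right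
      simp [h, h0]
  · left
    rw [h]
    nlinarith

theorem re_sqrt_pos {z : ℂ} (hz : z ∈ Complex.slitPlane) : 0 < (Complex.sqrt z).re := by
  rw [Complex.sqrt, Complex.cpow_inv_two_re]
  refine Real.sqrt_pos.2 (half_pos ?_)
  rcases Complex.mem_slitPlane_iff.1 hz with h | h
  · positivity
  · have := Complex.abs_re_lt_norm.2 h
    linarith [neg_abs_le z.re]

theorem sqrt_sq (z : ℂ) : Complex.sqrt z ^ 2 = z := by
  rw [Complex.sqrt]
  exact_mod_cast Complex.cpow_nat_inv_pow z two_ne_zero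

/-! ### The kernel `φ^a` -/

/-- Away from the origin `x_j yukD κ ‖x‖` is `∂_j` of the Yukawa potential, so this form exhibits
`φ^a` as `-iα·∇ + mβ + a` applied to that potential. -/
theorem phi_eq (m : ℝ) (a : ℂ) (x : Space) :
    phi m a x = yuk (Complex.sqrt ((m : ℂ) ^ 2 - a ^ 2)) ‖x‖ •
        (a • (1 : Matrix (Fin 4) (Fin 4) ℂ) + (m : ℂ) • beta) +
      ∑ j : Fin 3, ((x j : ℂ) * yukD (Complex.sqrt ((m : ℂ) ^ 2 - a ^ 2)) ‖x‖) •
        ((-Complex.I) • alpha j) := by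
  simp only [phi]
  set κ := Complex.sqrt ((m : ℂ) ^ 2 - a ^ 2)
  rw [smul_add, Finset.smul_sum, Finset.smul_sum]
  refine congrArg₂ _ rfl (Finset.sum_congr rfl fun j _ => ?_)
  rw [smul_smul, smul_smul, smul_smul]
  congr 1
  rw [yukD]
  rcases eq_or_ne x 0 with rfl | hx
  · simp
  have hx' : (‖x‖ : ℂ) ≠ 0 := by simpa using hx
  have hπ : (Real.pi : ℂ) ≠ 0 := Complex.ofReal_ne_zero.2 Real.pi_ne_zero
  field_simp

/-- The kernel `φ^a` as an operator-valued function. -/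
def phiL (m : ℝ) (a : ℂ) (x : Space) : Spinor →L[ℂ] Spinor :=
  Matrix.toEuclideanCLM (n := Fin 4) (𝕜 := ℂ) (phi m a x)

theorem phiL_eq (m : ℝ) (a : ℂ) (x : Space) :
    phiL m a x = yuk (Complex.sqrt ((m : ℂ) ^ 2 - a ^ 2)) ‖x‖ •
        (a • (1 : Spinor →L[ℂ] Spinor) + (m : ℂ) • Matrix.toEuclideanCLM (n := Fin 4) (𝕜 := ℂ) beta) +
      ∑ j : Fin 3, ((x j : ℂ) * yukD (Complex.sqrt ((m : ℂ) ^ 2 - a ^ 2)) ‖x‖) •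
        ((-Complex.I) • Matrix.toEuclideanCLM (n := Fin 4) (𝕜 := ℂ) (alpha j)) := by
  simp only [phiL, phi_eq, map_add, map_sum, map_smul, map_one]

theorem measurable_yuk (κ : ℂ) : Measurable (yuk κ) := by
  unfold yuk; fun_prop

theorem measurable_yukD (κ : ℂ) : Measurable (yukD κ) := by
  unfold yukD; fun_prop

/-- Half of the exponential decay is spent on `r e^{-cr} ≤ 1/c`, with `c = κ.re / 2`. This absorbs
the factor `1 + ‖κ‖ r` and brings both kernels under the common majorant `e^{-cr}/r²`, integrable at
the origin and at infinity. -/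
theorem exists_norm_yuk_le_exp {κ : ℂ} (hκ : 0 < κ.re) :
    ∃ C : ℝ, 0 ≤ C ∧ ∀ r : ℝ, 0 < r →
      ‖yuk κ r‖ ≤ C * (Real.exp (-(κ.re / 2) * r) / r ^ 2) ∧
      r * ‖yukD κ r‖ ≤ C * (Real.exp (-(κ.re / 2) * r) / r ^ 2) := by
  have hκ' : 0 < (κ / 2).re := by simpa using hκ
  set c := κ.re / 2 with hc
  have hc0 : 0 < c := by positivity
  refine ⟨1 + (1 + ‖κ‖) / c, by positivity, fun r hr => ?_⟩
  set E := Real.exp (-c * r) with hE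
  have hE0 : 0 < E := Real.exp_pos _
  have he : ‖Complex.exp (-κ * r)‖ = E * E := by
    rw [Complex.norm_exp, hE, ← Real.exp_add]
    congr 1
    simp [hc]
    ring
  have hrE : r * E ≤ 1 / c := by
    rw [le_div_iff₀ hc0, hE, neg_mul, Real.exp_neg]
    have := Real.add_one_le_exp (c * r)
    have h0 := Real.exp_pos (c * r)
    rw [mul_right_comm, mul_inv_le_iff₀ h0]
    linarith
  have hE1 : E ≤ 1 := Real.exp_le_one_iff.2 (by nlinarith)
  have hπ : 1 ≤ 4 * Real.pi := by linarith [Real.pi_gt_three]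
  have hn (n : ℕ) : ‖(4 * Real.pi * r ^ n : ℂ)‖ = 4 * Real.pi * r ^ n := by
    rw [norm_mul, norm_mul, norm_pow, Complex.norm_real, Complex.norm_real,
      Real.norm_of_nonneg hr.le, Real.norm_of_nonneg Real.pi_pos.le, Complex.norm_ofNat]
  have hle (n : ℕ) (t : ℝ) (ht : 0 ≤ t) : t / (4 * Real.pi * r ^ n) ≤ t / r ^ n :=
    div_le_div_of_nonneg_left ht (by positivity) (le_mul_of_one_le_left (by positivity) hπ)
  have hk : 0 ≤ ‖κ‖ / c := by positivity
  constructor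
  · have h1 : ‖yuk κ r‖ ≤ E * E / r ^ 1 := by
      have := hn 1
      rw [pow_one] at this
      rw [yuk, norm_div, he, this]
      simpa using hle 1 (E * E) (by positivity)
    refine h1.trans ?_
    have h2 : E * E / r ^ 1 = (r * E) * (E / r ^ 2) := by field_simp
    rw [h2]
    gcongr
    refine hrE.trans ?_
    rw [add_div]
    linarith
  · have h1 : ‖yukD κ r‖ ≤ (1 + ‖κ‖ * r) * (E * E) / r ^ 3 := by
      rw [yukD, norm_div, norm_neg, norm_mul, he, hn 3]
      refine (hle 3 _ (by positivity)).trans ?_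
      gcongr
      refine (norm_add_le _ _).trans ?_
      rw [norm_mul, Complex.norm_real, Real.norm_of_nonneg hr.le, norm_one]
    refine (mul_le_mul_of_nonneg_left h1 hr.le).trans ?_
    have h2 : r * ((1 + ‖κ‖ * r) * (E * E) / r ^ 3) = (E + ‖κ‖ * (r * E)) * (E / r ^ 2) := by
      field_simp
    rw [h2]
    gcongr
    have h3 := mul_le_mul_of_nonneg_left hrE (norm_nonneg κ)
    rw [add_div]
    have h4 : ‖κ‖ * (1 / c) = ‖κ‖ / c := by ring
    have h5 : 0 ≤ 1 / c := by positivity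
    linarith

theorem integrable_exp_neg_div_sq {c : ℝ} (hc : 0 < c) :
    Integrable fun x : Space => Real.exp (-c * ‖x‖) / ‖x‖ ^ 2 := by
  rw [integrable_fun_norm_addHaar volume (f := fun r => Real.exp (-c * r) / r ^ 2)]
  refine (integrableOn_exp_mul_Ioi (neg_lt_zero.2 hc) 0).congr_fun (fun r hr => ?_)
    measurableSet_Ioi
  have hr' : r ≠ 0 := ne_of_gt hr
  simp only [finrank_euclideanSpace, Fintype.card_fin, Nat.add_one_sub_one, smul_eq_mul]
  field_simp

theorem abs_apply_le_norm (x : Space) (j : Fin 3) : |x j| ≤ ‖x‖ := by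
  simpa using PiLp.norm_apply_le x j

theorem integrable_phiL {m : ℝ} {a : ℂ} (hz : (m : ℂ) ^ 2 - a ^ 2 ∈ Complex.slitPlane) :
    Integrable (phiL m a) := by
  have hκ := re_sqrt_pos hz
  set κ := Complex.sqrt ((m : ℂ) ^ 2 - a ^ 2) with hκd
  obtain ⟨C, hC, h⟩ := exists_norm_yuk_le_exp hκ
  have hE := (integrable_exp_neg_div_sq (half_pos hκ)).const_mul C
  have h0 : ∀ᵐ x : Space, x ≠ 0 := compl_mem_ae_iff.2 (measure_singleton 0)
  have h1 : Integrable fun x : Space => yuk κ ‖x‖ := by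
    refine hE.mono' ((measurable_yuk κ).comp measurable_norm).aestronglyMeasurable ?_
    filter_upwards [h0] with x hx using (h _ (norm_pos_iff.2 hx)).1
  have h2 (j : Fin 3) : Integrable fun x : Space => (x j : ℂ) * yukD κ ‖x‖ := by
    refine hE.mono' (Measurable.aestronglyMeasurable ?_) ?_
    · have := (measurable_yukD κ).comp (measurable_norm (α := Space))
      exact Measurable.mul (by fun_prop) this
    · filter_upwards [h0] with x hx
      rw [norm_mul, Complex.norm_real, Real.norm_eq_abs]
      exact (mul_le_mul_of_nonneg_right (abs_apply_le_norm x j) (norm_nonneg _)).trans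
        (h _ (norm_pos_iff.2 hx)).2
  have h3 := (h1.smul_const (a • (1 : Spinor →L[ℂ] Spinor) +
    (m : ℂ) • Matrix.toEuclideanCLM (n := Fin 4) (𝕜 := ℂ) beta)).add
    (integrable_finsetSum Finset.univ fun j _ => (h2 j).smul_const
      ((-Complex.I) • Matrix.toEuclideanCLM (n := Fin 4) (𝕜 := ℂ) (alpha j)))
  refine h3.congr (ae_of_all _ fun x => ?_)
  rw [phiL_eq]
  simp only [Pi.add_apply]
  rfl

theorem isConvolutionOp_Phi {m : ℝ} {a : ℂ} (hz : (m : ℂ) ^ 2 - a ^ 2 ∈ Complex.slitPlane) :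
    IsConvolutionOp (phi m a) (Phi m a) := by
  have h : ∃ T : L2 →L[ℂ] L2, IsConvolutionOp (phi m a) T :=
    ⟨convL (integrable_phiL hz), fun G => convL_apply_ae (integrable_phiL hz) G⟩
  rw [Phi, dif_pos h]
  exact h.choose_spec

/-! ### `Φ^a` is the resolvent of the free Dirac operator -/

theorem integrable_yuk_smul {κ : ℂ} (hκ : 0 < κ.re) (f : 𝓢(Space, Spinor)) (x : Space) :
    Integrable fun y => yuk κ ‖x - y‖ • f y := by
  obtain ⟨C, hC, h⟩ := exists_norm_yuk_le hκ
  refine (integrable_invSqCut_mul_schwartz f x C).mono' ?_ (ae_of_all _ fun y => ?_)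
  · have h1 : Measurable fun y : Space => yuk κ ‖x - y‖ := (measurable_yuk κ).comp (by fun_prop)
    exact h1.aestronglyMeasurable.smul f.continuous.aestronglyMeasurable
  · rw [norm_smul]
    gcongr
    refine (h _ (norm_nonneg _)).1.trans ?_
    rw [div_eq_mul_inv]
    gcongr
    simpa using inv_norm_pow_le (x - y) (k := 1) (by norm_num)

theorem integrable_inner_mul_yukD_smul {κ : ℂ} (hκ : 0 < κ.re) (j : Fin 3) (f : 𝓢(Space, Spinor))
    (x : Space) : Integrable fun y => ((((x - y) j : ℝ) : ℂ) * yukD κ ‖x - y‖) • f y := by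
  obtain ⟨C, hC, h⟩ := exists_norm_yuk_le hκ
  refine (integrable_invSqCut_mul_schwartz f x C).mono' ?_ (ae_of_all _ fun y => ?_)
  · have h1 : Measurable fun y : Space => yukD κ ‖x - y‖ := (measurable_yukD κ).comp (by fun_prop)
    have h2 : Measurable fun y : Space => (((x - y) j : ℝ) : ℂ) * yukD κ ‖x - y‖ :=
      Measurable.mul (by fun_prop) h1
    exact h2.aestronglyMeasurable.smul f.continuous.aestronglyMeasurable
  · rw [norm_smul]
    gcongr
    rw [norm_mul, Complex.norm_real, Real.norm_eq_abs]
    refine (mul_le_mul (abs_apply_le_norm _ j) (h _ (norm_nonneg _)).2.1 (norm_nonneg _)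
      (norm_nonneg _)).trans ?_
    have h3 : ‖x - y‖ * (C / ‖x - y‖ ^ 3) = C * (‖x - y‖ ^ 2)⁻¹ := by
      rcases eq_or_ne ‖x - y‖ 0 with h0 | h0
      · simp [h0]
      · field_simp
    rw [h3]
    gcongr
    exact inv_norm_pow_le (x - y) le_rfl

theorem coe_schwartz_injective {f g : 𝓢(Space, Spinor)}
    (h : (f : 𝓢'(Space, Spinor)) = (g : 𝓢'(Space, Spinor))) : f = g := by
  rw [← Lp.toTemperedDistribution_toLp_eq (p := 2), ← Lp.toTemperedDistribution_toLp_eq (p := 2)]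
    at h
  exact SchwartzMap.injective_toLp 2 volume (toTemperedDistribution_inj h)

/-- Convolution with the Yukawa potential is the Fourier multiplier `(κ² - Δ)⁻¹`. -/
theorem integral_yuk_smul_eq_fourierMultiplier {κ : ℂ} (hκ : 0 < κ.re)
    (hz : κ ^ 2 ∈ Complex.slitPlane) (f : 𝓢(Space, Spinor)) (x : Space) :
    ∫ y, yuk κ ‖x - y‖ • f y =
      SchwartzMap.fourierMultiplierCLM Spinor (yukawaSymbol (κ ^ 2)) f x := by
  set h := SchwartzMap.fourierMultiplierCLM Spinor (yukawaSymbol (κ ^ 2)) f with hh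
  -- The multiplier keeps `h` a Schwartz function, so the fundamental solution may be applied to `f
  -- = (κ² - Δ) h` and returns `h`.
  have e : κ ^ 2 • h - Laplacian.laplacian h = f := by
    apply coe_schwartz_injective
    rw [map_sub, map_smul, ← laplacian_toTemperedDistributionCLM_eq, hh,
      ← fourierMultiplierCLM_toTemperedDistributionCLM_eq (yukawaSymbol_hasTemperateGrowth hz)]
    exact smul_sub_laplacian_yukawa hz _
  rw [← integral_yuk_smul_helmholtz hκ h x, e]

/-- The operator `-i ∑ αⱼ Qⱼ + m β P + a P`, applied to `Q` in place of the gradient of `P`. -/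
def diracSum (m : ℝ) (a : ℂ) (P : L2) (Q : Fin 3 → L2) : L2 :=
  (∑ j : Fin 3, (-Complex.I) • matOp (alpha j) (Q j)) + (m : ℂ) • matOp beta P + a • P

theorem sum_add_smul_ae (F : Fin 3 → L2) (b a : ℂ) (P Q : L2) :
    ((∑ j, F j) + b • P + a • Q : L2) =ᵐ[volume]
      fun x => (∑ j, F j x) + b • P x + a • Q x := by
  rw [Fin.sum_univ_three]
  filter_upwards [Lp.coeFn_add (F 0 + F 1 + F 2 + b • P) (a • Q),
    Lp.coeFn_add (F 0 + F 1 + F 2) (b • P), Lp.coeFn_add (F 0 + F 1) (F 2),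
    Lp.coeFn_add (F 0) (F 1), Lp.coeFn_smul b P, Lp.coeFn_smul a Q] with x h1 h2 h3 h4 h5 h6
  rw [h1, Pi.add_apply, h2, Pi.add_apply, h3, Pi.add_apply, h4, Pi.add_apply, h5, h6,
    Fin.sum_univ_three]
  rfl

theorem smul_matOp_apply_ae (c : ℂ) (M : Matrix (Fin 4) (Fin 4) ℂ) (P : L2) :
    ∀ᵐ x, (c • matOp M P : L2) x = c • Matrix.toEuclideanCLM (n := Fin 4) (𝕜 := ℂ) M (P x) := by
  filter_upwards [Lp.coeFn_smul c (matOp M P), matOp_apply_ae M P] with x h1 h2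
  rw [h1, Pi.smul_apply, h2]

theorem diracSum_apply_ae (m : ℝ) (a : ℂ) (P : L2) (Q : Fin 3 → L2) :
    ∀ᵐ x, diracSum m a P Q x = (∑ j : Fin 3, (-Complex.I) •
      Matrix.toEuclideanCLM (n := Fin 4) (𝕜 := ℂ) (alpha j) (Q j x)) +
      (m : ℂ) • Matrix.toEuclideanCLM (n := Fin 4) (𝕜 := ℂ) beta (P x) + a • P x := by
  filter_upwards [sum_add_smul_ae (fun j => (-Complex.I) • matOp (alpha j) (Q j)) (m : ℂ) a
    (matOp beta P) P, ae_all_iff.2 fun j => smul_matOp_apply_ae (-Complex.I) (alpha j) (Q j),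
    matOp_apply_ae beta P] with x h1 h2 h3
  rw [diracSum, h1, h3]
  simp only [h2]

/-- The value of `φ^a * f` for a Schwartz function `f`. -/
theorem integral_phi_apply {m : ℝ} {a : ℂ} (hz : (m : ℂ) ^ 2 - a ^ 2 ∈ Complex.slitPlane)
    (f : 𝓢(Space, Spinor)) (x : Space) :
    ∫ y, phiL m a (x - y) (f y) = (∑ j : Fin 3, (-Complex.I) •
      Matrix.toEuclideanCLM (n := Fin 4) (𝕜 := ℂ) (alpha j)
        (SchwartzMap.fourierMultiplierCLM Spinor (yukawaSymbol ((m : ℂ) ^ 2 - a ^ 2))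
          (∂_{basisVec j} f : 𝓢(Space, Spinor)) x)) +
      (m : ℂ) • Matrix.toEuclideanCLM (n := Fin 4) (𝕜 := ℂ) beta
        (SchwartzMap.fourierMultiplierCLM Spinor (yukawaSymbol ((m : ℂ) ^ 2 - a ^ 2)) f x) +
      a • SchwartzMap.fourierMultiplierCLM Spinor (yukawaSymbol ((m : ℂ) ^ 2 - a ^ 2)) f x := by
  have hκ := re_sqrt_pos hz
  have hκ2 := sqrt_sq ((m : ℂ) ^ 2 - a ^ 2)
  have hY (g : 𝓢(Space, Spinor)) (x : Space) :
      ∫ y, yuk (Complex.sqrt ((m : ℂ) ^ 2 - a ^ 2)) ‖x - y‖ • g y =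
      SchwartzMap.fourierMultiplierCLM Spinor (yukawaSymbol ((m : ℂ) ^ 2 - a ^ 2)) g x := by
    have := integral_yuk_smul_eq_fourierMultiplier hκ (by rwa [hκ2]) g x
    rwa [hκ2] at this
  set κ := Complex.sqrt ((m : ℂ) ^ 2 - a ^ 2) with hκd
  set A : Spinor →L[ℂ] Spinor := a • (1 : Spinor →L[ℂ] Spinor) +
    (m : ℂ) • Matrix.toEuclideanCLM (n := Fin 4) (𝕜 := ℂ) beta with hA
  set B : Fin 3 → Spinor →L[ℂ] Spinor := fun j =>
    (-Complex.I) • Matrix.toEuclideanCLM (n := Fin 4) (𝕜 := ℂ) (alpha j) with hB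
  have h2 (y : Space) : phiL m a (x - y) (f y) = A (yuk κ ‖x - y‖ • f y) +
      ∑ j : Fin 3, B j (((((x - y) j : ℝ) : ℂ) * yukD κ ‖x - y‖) • f y) := by
    rw [phiL_eq]
    simp only [_root_.add_apply, _root_.sum_apply, _root_.smul_apply, map_smul, hA, hB]
    rfl
  have i1 := integrable_yuk_smul hκ f x
  have i2 (j : Fin 3) := integrable_inner_mul_yukD_smul hκ j f x
  simp only [h2]
  rw [integral_add (A.integrable_comp i1) (integrable_finsetSum _ fun j _ =>
      (B j).integrable_comp (i2 j)), integral_finsetSum _ fun j _ => (B j).integrable_comp (i2 j),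
    A.integral_comp_comm i1, hY]
  -- The derivative on the Yukawa potential is moved to `f`, which leaves a pure Yukawa convolution
  -- of `∂_j f`.
  have h3 (j : Fin 3) : ∫ y, B j (((((x - y) j : ℝ) : ℂ) * yukD κ ‖x - y‖) • f y) =
      B j (SchwartzMap.fourierMultiplierCLM Spinor (yukawaSymbol ((m : ℂ) ^ 2 - a ^ 2))
        (∂_{basisVec j} f : 𝓢(Space, Spinor)) x) := by
    rw [(B j).integral_comp_comm (i2 j), ← hY, integral_yuk_smul_lineDeriv hκ]
    simp only [inner_basisVec]
  rw [Finset.sum_congr rfl fun j _ => h3 j]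
  simp only [hA, hB, _root_.add_apply, _root_.smul_apply, one_apply_eq_self]
  abel

theorem coe_diracSum (m : ℝ) (a : ℂ) (P : L2) (Q : Fin 3 → L2) :
    (diracSum m a P Q : 𝓢'(Space, Spinor)) =
      (∑ j : Fin 3, (-Complex.I) • distMat (alpha j) (Q j : 𝓢'(Space, Spinor))) +
        (m : ℂ) • distMat beta (P : 𝓢'(Space, Spinor)) + a • (P : 𝓢'(Space, Spinor)) := by
  rw [← Lp.toTemperedDistributionCLM_apply, diracSum]
  simp only [map_add, map_sum, map_smul]
  simp only [Lp.toTemperedDistributionCLM_apply, ← distMat_coe]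

theorem yukawa_schwartz {z : ℂ} (hz : z ∈ Complex.slitPlane) (g : 𝓢(Space, Spinor)) :
    fourierMultiplierCLM Spinor (yukawaSymbol z) (g : 𝓢'(Space, Spinor)) =
      (((SchwartzMap.fourierMultiplierCLM Spinor (yukawaSymbol z) g).toLp 2 : L2) :
        𝓢'(Space, Spinor)) := by
  have h : (((SchwartzMap.fourierMultiplierCLM Spinor (yukawaSymbol z) g).toLp 2 : L2) :
        𝓢'(Space, Spinor)) = ((SchwartzMap.fourierMultiplierCLM Spinor (yukawaSymbol z) g :
          𝓢(Space, Spinor)) : 𝓢'(Space, Spinor)) := Lp.toTemperedDistribution_toLp_eq _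
  exact (fourierMultiplierCLM_toTemperedDistributionCLM_eq
    (yukawaSymbol_hasTemperateGrowth hz) g).trans h.symm

theorem distDirac_yukawa_schwartz {m : ℝ} {a : ℂ} (hz : (m : ℂ) ^ 2 - a ^ 2 ∈ Complex.slitPlane)
    (f : 𝓢(Space, Spinor)) :
    distDirac m a (fourierMultiplierCLM Spinor (yukawaSymbol ((m : ℂ) ^ 2 - a ^ 2))
      (f : 𝓢'(Space, Spinor))) = ((diracSum m a
        ((SchwartzMap.fourierMultiplierCLM Spinor (yukawaSymbol ((m : ℂ) ^ 2 - a ^ 2)) f).toLp 2)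
        fun j => (SchwartzMap.fourierMultiplierCLM Spinor (yukawaSymbol ((m : ℂ) ^ 2 - a ^ 2))
          (∂_{basisVec j} f : 𝓢(Space, Spinor))).toLp 2 : L2) : 𝓢'(Space, Spinor)) := by
  have hTd (g : 𝓢(Space, Spinor)) := yukawa_schwartz hz g
  have e : ∀ j, (∂_{basisVec j} (fourierMultiplierCLM Spinor (yukawaSymbol ((m : ℂ) ^ 2 - a ^ 2))
      (f : 𝓢'(Space, Spinor))) : 𝓢'(Space, Spinor)) =
      (((SchwartzMap.fourierMultiplierCLM Spinor (yukawaSymbol ((m : ℂ) ^ 2 - a ^ 2))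
          (∂_{basisVec j} f : 𝓢(Space, Spinor))).toLp 2 : L2) : 𝓢'(Space, Spinor)) := fun j => by
    rw [lineDerivOp_yukawa hz, lineDerivOp_toTemperedDistributionCLM_eq, hTd]
  rw [coe_diracSum, distDirac, Finset.sum_congr rfl fun j _ => by rw [e j], hTd]

/-- On Schwartz functions both operators are explicit: convolution with `φ^a` splits into Yukawa
convolutions of `f` and `∂_j f`, while `∂_j` commutes with the multiplier in `(H + a)(κ² - Δ)⁻¹`. -/
theorem isResolventAt_Phi {m : ℝ} {a : ℂ} (hz : (m : ℂ) ^ 2 - a ^ 2 ∈ Complex.slitPlane) :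
    IsResolventAt (freeDirac m) a (Phi m a) := by
  refine isResolventAt_freeDirac hz fun f => ?_
  rw [distDirac_yukawa_schwartz hz]
  congr 1
  refine Lp.ext ?_
  filter_upwards [isConvolutionOp_Phi hz (f.toLp 2 volume), diracSum_apply_ae m a
    ((SchwartzMap.fourierMultiplierCLM Spinor (yukawaSymbol ((m : ℂ) ^ 2 - a ^ 2)) f).toLp 2 volume)
    fun j => (SchwartzMap.fourierMultiplierCLM Spinor (yukawaSymbol ((m : ℂ) ^ 2 - a ^ 2))
          (∂_{basisVec j} f : 𝓢(Space, Spinor))).toLp 2 volume,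
    SchwartzMap.coeFn_toLp
      (SchwartzMap.fourierMultiplierCLM Spinor (yukawaSymbol ((m : ℂ) ^ 2 - a ^ 2)) f) 2 volume,
    ae_all_iff.2 fun j : Fin 3 => SchwartzMap.coeFn_toLp
      (SchwartzMap.fourierMultiplierCLM Spinor (yukawaSymbol ((m : ℂ) ^ 2 - a ^ 2))
          (∂_{basisVec j} f : 𝓢(Space, Spinor))) 2 volume] with x hx h1 h2 h3
  rw [hx.2, h1, h2]
  simp only [h3]
  rw [← integral_phi_apply hz]
  refine integral_congr_ae ?_
  filter_upwards [SchwartzMap.coeFn_toLp f 2 volume] with y hy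
  rw [hy]; rfl

/-! ### Graph coordinates -/

/-- The plane `ℝ²`. -/
abbrev Plane : Type := EuclideanSpace ℝ (Fin 2)

/-- The projection `(x₁, x₂, x₃) ↦ (x₁, x₂)`. -/
def horiz : Space →L[ℝ] Plane :=
  LinearMap.toContinuousLinearMap
    { toFun := fun z => !₂[z 0, z 1]
      map_add' := fun x y => by ext i; fin_cases i <;> simp
      map_smul' := fun c x => by ext i; fin_cases i <;> simp }

theorem horiz_apply (z : Space) : horiz z = !₂[z 0, z 1] := rfl

/-- The inclusion `(x₁, x₂) ↦ (x₁, x₂, 0)`. -/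
def planeIncl : Plane →L[ℝ] Space :=
  LinearMap.toContinuousLinearMap
    { toFun := fun w => !₂[w 0, w 1, 0]
      map_add' := fun x y => by ext i; fin_cases i <;> simp
      map_smul' := fun c x => by ext i; fin_cases i <;> simp }

theorem planeIncl_apply (w : Plane) : planeIncl w = !₂[w 0, w 1, 0] := rfl

@[simp] theorem horiz_planeIncl_add (w : Plane) (s : ℝ) :
    horiz (planeIncl w + s • basisVec 2) = w := by
  ext i; fin_cases i <;> simp [horiz_apply, planeIncl_apply, basisVec]

@[simp] theorem planeIncl_add_apply_two (w : Plane) (s : ℝ) :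
    (planeIncl w + s • basisVec 2) 2 = s := by
  simp [planeIncl_apply, basisVec]

theorem planeIncl_horiz_add (z : Space) : planeIncl (horiz z) + z 2 • basisVec 2 = z := by
  ext i; fin_cases i <;> simp [horiz_apply, planeIncl_apply, basisVec]

theorem inner_planeIncl_add (v w : Plane) (s t : ℝ) :
    inner ℝ (planeIncl v + s • basisVec 2) (planeIncl w + t • basisVec 2) =
      inner ℝ v w + s * t := by
  simp [PiLp.inner_apply, Fin.sum_univ_three, planeIncl_apply, basisVec]
  ring

/-- In the ball of radius `r` around `Q₀`, in the coordinates `L` with origin `Q₀`, the set `Ω` is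
the region above the graph of `ψ`, and its boundary is the graph. -/
def IsGraphChart (Ω : Set Space) (Q₀ : Space) (r : ℝ) (ψ : Plane → ℝ) (L : Space ≃ₗᵢ[ℝ] Space) :
    Prop :=
  ∀ x ∈ Metric.ball Q₀ r, (x ∈ Ω ↔ ψ (horiz (L (x - Q₀))) < L (x - Q₀) 2) ∧
    (x ∈ frontier Ω ↔ L (x - Q₀) 2 = ψ (horiz (L (x - Q₀))))

/-- The point of the graph of `ψ` above `y`. -/
def graphPt (Q₀ : Space) (ψ : Plane → ℝ) (L : Space ≃ₗᵢ[ℝ] Space) (y : Plane) : Space :=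
  Q₀ + L.symm (planeIncl y + ψ y • basisVec 2)

/-- The function that defines the graph of `ψ`. -/
def graphFun (Q₀ : Space) (ψ : Plane → ℝ) (L : Space ≃ₗᵢ[ℝ] Space) (x : Space) : ℝ :=
  L (x - Q₀) 2 - ψ (horiz (L (x - Q₀)))

/-- The gradient of `graphFun`. -/
def graphGrad (ψ : Plane → ℝ) (L : Space ≃ₗᵢ[ℝ] Space) (y : Plane) : Space :=
  L.symm (planeIncl (-gradient ψ y) + (1 : ℝ) • basisVec 2)

/-- The unit normal to the graph of `ψ` that points downwards. -/
def graphNormal (ψ : Plane → ℝ) (L : Space ≃ₗᵢ[ℝ] Space) (y : Plane) : Space :=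
  -((‖graphGrad ψ L y‖)⁻¹ • graphGrad ψ L y)

section Graph

variable {Q₀ : Space} {ψ : Plane → ℝ} {L : Space ≃ₗᵢ[ℝ] Space}

theorem inner_gradient (y w : Plane) :
    inner ℝ (gradient ψ y) w = fderiv ℝ ψ y w := by
  rw [gradient, InnerProductSpace.toDual_symm_apply]

theorem inner_graphGrad (y w : Plane) (s : ℝ) :
    inner ℝ (graphGrad ψ L y) (L.symm (planeIncl w + s • basisVec 2)) =
      s - fderiv ℝ ψ y w := by
  rw [graphGrad, LinearIsometryEquiv.inner_map_map, inner_planeIncl_add, inner_neg_left,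
    gradient, InnerProductSpace.toDual_symm_apply]
  ring

theorem graphGrad_ne_zero (y : Plane) : graphGrad ψ L y ≠ 0 := by
  intro h
  have := inner_graphGrad (ψ := ψ) (L := L) y 0 1
  simp [h] at this

theorem norm_graphNormal (y : Plane) : ‖graphNormal ψ L y‖ = 1 := by
  rw [graphNormal, norm_neg, norm_smul, norm_inv, norm_norm,
    inv_mul_cancel₀ (norm_ne_zero_iff.2 (graphGrad_ne_zero y))]

theorem hasFDerivAt_graphFun (hψ : Differentiable ℝ ψ) (x : Space) :
    HasFDerivAt (graphFun Q₀ ψ L) (innerSL ℝ (graphGrad ψ L (horiz (L (x - Q₀))))) x := by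
  have h0 : HasFDerivAt (fun x : Space => L (x - Q₀)) (L : Space →L[ℝ] Space) x :=
    (L : Space →L[ℝ] Space).hasFDerivAt.comp x ((hasFDerivAt_id x).sub_const Q₀)
  have h1 := ((EuclideanSpace.proj (𝕜 := ℝ) (2 : Fin 3)).hasFDerivAt.comp x h0)
  have h2 := (hψ (horiz (L (x - Q₀)))).hasFDerivAt.comp x (horiz.hasFDerivAt.comp x h0)
  refine (h1.sub h2).congr_fderiv ?_
  ext v
  have e := inner_graphGrad (ψ := ψ) (L := L) (horiz (L (x - Q₀))) (horiz (L v)) (L v 2)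
  rw [planeIncl_horiz_add, L.symm_apply_apply] at e
  exact e.symm

theorem hasFDerivAt_graphPt (hψ : Differentiable ℝ ψ) (y : Plane) :
    HasFDerivAt (graphPt Q₀ ψ L) ((L.symm : Space →L[ℝ] Space) ∘L
      (planeIncl + (fderiv ℝ ψ y).smulRight (basisVec 2))) y :=
  ((L.symm : Space →L[ℝ] Space).hasFDerivAt.comp y
    (planeIncl.hasFDerivAt.add ((hψ y).hasFDerivAt.smul_const (basisVec 2)))).const_add Q₀

theorem apply_graphPt (y : Plane) : L (graphPt Q₀ ψ L y - Q₀) = planeIncl y + ψ y • basisVec 2 := by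
  simp [graphPt]

theorem graphPt_eq {x : Space} (hx : L (x - Q₀) 2 = ψ (horiz (L (x - Q₀)))) :
    graphPt Q₀ ψ L (horiz (L (x - Q₀))) = x := by
  rw [graphPt, ← hx, planeIncl_horiz_add, L.symm_apply_apply, add_sub_cancel]

theorem differentiable_graphGrad (hψ : ContDiff ℝ 2 ψ) : Differentiable ℝ (graphGrad ψ L) := by
  have h1 : Differentiable ℝ (fderiv ℝ ψ) :=
    (hψ.fderiv_right (m := 1) (by norm_num)).differentiable (by norm_num)
  have h2 : Differentiable ℝ (gradient ψ) := fun y =>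
    ((InnerProductSpace.toDual ℝ Plane).symm.toContinuousLinearEquiv.differentiableAt).comp y (h1 y)
  unfold graphGrad
  fun_prop

theorem differentiable_graphNormal (hψ : ContDiff ℝ 2 ψ) :
    Differentiable ℝ (graphNormal ψ L) := fun y => by
  have h := differentiable_graphGrad (L := L) hψ y
  exact ((h.norm ℝ (graphGrad_ne_zero y)).inv
    (norm_ne_zero_iff.2 (graphGrad_ne_zero y))).smul h |>.neg

/-! ### The outward unit normal in a graph chart. -/

theorem _root_.HasDerivAt.eventually_lt_right {f : ℝ → ℝ} {f' x : ℝ} (h : HasDerivAt f f' x)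
    (hf' : 0 < f') : ∀ᶠ t in 𝓝[>] (0 : ℝ), f x < f (x + t) := by
  have h1 := (hasDerivAt_iff_tendsto_slope_zero.1 h).mono_left
    (nhdsWithin_mono 0 (fun t (ht : 0 < t) => ht.ne'))
  filter_upwards [h1.eventually_const_lt hf', self_mem_nhdsWithin] with t ht ht0
  have := mul_pos (show (0 : ℝ) < t from ht0) ht
  rw [smul_eq_mul, mul_inv_cancel_left₀ (ne_of_gt ht0)] at this
  linarith

/-- The tangent vectors of the graph lie in the tangent cone of the boundary, so a normal is a
multiple `c G` of the gradient; unit length fixes `|c|`, and `c < 0` because `graphFun` increases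
along `G`, into `Ω`. Conversely, `graphFun` vanishes on the boundary, so its derivative kills the
tangent cone. -/
theorem IsGraphChart.isOutwardUnitNormal_iff {Ω : Set Space} {r : ℝ}
    (h : IsGraphChart Ω Q₀ r ψ L) (hψ : Differentiable ℝ ψ) {Q : Space}
    (hQ : Q ∈ frontier Ω) (hQr : Q ∈ Metric.ball Q₀ r) (n : Space) :
    IsOutwardUnitNormal Ω Q n ↔ n = graphNormal ψ L (horiz (L (Q - Q₀))) := by
  set y := horiz (L (Q - Q₀)) with hy
  set G := graphGrad ψ L y with hG
  have hG0 : G ≠ 0 := graphGrad_ne_zero y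
  have hQ2 := ((h Q hQr).2.1 hQ)
  have hQy : graphPt Q₀ ψ L y = Q := graphPt_eq hQ2
  have hgQ : graphFun Q₀ ψ L Q = 0 := sub_eq_zero.2 hQ2
  have hball : Metric.ball Q₀ r ∈ 𝓝 Q := Metric.isOpen_ball.mem_nhds hQr
  have hline (v : Space) : HasDerivAt (fun t : ℝ => graphFun Q₀ ψ L (Q + t • v))
      (inner ℝ G v) 0 := by
    have h1 : HasDerivAt (fun t : ℝ => Q + t • v) v 0 := by
      simpa using ((hasDerivAt_id (0 : ℝ)).smul_const v).const_add Q
    have h2 : HasFDerivAt (graphFun Q₀ ψ L) (innerSL ℝ G) (Q + (0 : ℝ) • v) := by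
      rw [zero_smul, add_zero]; exact hasFDerivAt_graphFun hψ Q
    exact h2.comp_hasDerivAt (0 : ℝ) h1
  have hlim (v : Space) : ∀ᶠ t in 𝓝[>] (0 : ℝ), Q + t • v ∈ Metric.ball Q₀ r := by
    have h1 : Tendsto (fun t : ℝ => Q + t • v) (𝓝[>] 0) (𝓝 Q) := by
      have : Continuous fun t : ℝ => Q + t • v := by fun_prop
      simpa using (this.tendsto 0).mono_left nhdsWithin_le_nhds
    exact h1 hball
  constructor
  · rintro ⟨hn, ht, ho⟩
    have hperp (w : Plane) : inner ℝ n (L.symm (planeIncl w + fderiv ℝ ψ y w • basisVec 2)) = 0 := by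
      apply ht
      have hU : graphPt Q₀ ψ L ⁻¹' Metric.ball Q₀ r ∈ 𝓝 y :=
        (hasFDerivAt_graphPt hψ y).continuousAt (hQy ▸ hball)
      have hm := (hasFDerivAt_graphPt (Q₀ := Q₀) (L := L) hψ y).hasFDerivWithinAt
        (s := graphPt Q₀ ψ L ⁻¹' Metric.ball Q₀ r) |>.mapsTo_tangent_cone
      rw [tangentConeAt_of_mem_nhds hU] at hm
      have hs : graphPt Q₀ ψ L '' (graphPt Q₀ ψ L ⁻¹' Metric.ball Q₀ r) ⊆ frontier Ω := by
        rintro _ ⟨z, hz, rfl⟩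
        refine (h _ hz).2.2 ?_
        rw [apply_graphPt, horiz_planeIncl_add, planeIncl_add_apply_two]
      have := tangentConeAt_mono hs (hm (mem_univ w))
      rw [hQy] at this
      exact this
    obtain ⟨c, hc⟩ : ∃ c : ℝ, n = c • G := by
      -- In the coordinates `L` the gradient is `(-∇ψ, 1)`, so the factor is read off from the third
      -- coordinate.
      refine ⟨L n 2, ?_⟩
      have h1 : horiz (L n) = -(L n 2 • gradient ψ y) := by
        refine ext_inner_right ℝ fun w => ?_
        have e := hperp w
        rw [← L.inner_map_map, L.apply_symm_apply, ← planeIncl_horiz_add (L n),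
          inner_planeIncl_add] at e
        rw [inner_neg_left, inner_smul_left, inner_gradient]
        simp only [conj_trivial]
        linarith
      apply L.injective
      rw [hG, graphGrad, map_smul, L.apply_symm_apply]
      conv_lhs => rw [← planeIncl_horiz_add (L n), h1]
      rw [smul_add, smul_smul, mul_one, ← map_smul, smul_neg]
    have hc1 : |c| * ‖G‖ = 1 := by rw [← hn, hc, norm_smul, Real.norm_eq_abs]
    have hGpos : 0 < ‖G‖ := norm_pos_iff.2 hG0
    have hcneg : c < 0 := by
      by_contra! hc0
      have hcpos : 0 < c := lt_of_le_of_ne hc0 fun h0 => by simp [← h0] at hc1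
      have hin : 0 < inner ℝ G n := by
        rw [hc, inner_smul_right, real_inner_self_eq_norm_sq]; positivity
      have h3 := (hline n).eventually_lt_right hin
      obtain ⟨t, ht1, ht2, ht3⟩ := (ho.and (h3.and (hlim n))).exists
      refine ht1 ((h _ ht3).1.2 ?_)
      rw [zero_smul, add_zero, hgQ, zero_add] at ht2
      exact sub_pos.1 ht2
    rw [abs_of_neg hcneg] at hc1
    rw [graphNormal, ← hG, hc, ← neg_smul]
    congr 1
    field_simp
    linarith
  · rintro rfl
    refine ⟨norm_graphNormal y, fun w hw => ?_, ?_⟩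
    · have hw' : w ∈ tangentConeAt ℝ (frontier Ω ∩ Metric.ball Q₀ r) Q := by
        rwa [tangentConeAt_inter_nhds hball]
      have hm := (hasFDerivAt_graphFun (Q₀ := Q₀) (L := L) hψ Q).hasFDerivWithinAt
        (s := frontier Ω ∩ Metric.ball Q₀ r) |>.mapsTo_tangent_cone hw'
      have hs : graphFun Q₀ ψ L '' (frontier Ω ∩ Metric.ball Q₀ r) ⊆ {0} := by
        rintro _ ⟨z, hz, rfl⟩
        exact sub_eq_zero.2 ((h z hz.2).2.1 hz.1)
      -- The derivative maps the tangent cone into that of the one-point set `{0}`, which contains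
      -- only zero.
      have hz := tangentConeAt_subset_zero (𝕜 := ℝ) (s := ({0} : Set ℝ))
        (x := graphFun Q₀ ψ L Q) (by
          rw [hgQ, accPt_iff_frequently]
          exact fun hf => hf (Eventually.of_forall fun y hy => hy.1 hy.2)) (tangentConeAt_mono hs hm)
      have hz' : inner ℝ G w = 0 := hz
      rw [graphNormal, inner_neg_left, inner_smul_left, ← hG, hz', mul_zero, neg_zero]
    · have hin : 0 < -inner ℝ G (graphNormal ψ L y) := by
        rw [graphNormal, ← hG, inner_neg_right, neg_neg, inner_smul_right,
          real_inner_self_eq_norm_sq]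
        have : 0 < ‖G‖ := norm_pos_iff.2 hG0
        positivity
      filter_upwards [(hline (graphNormal ψ L y)).neg.eventually_lt_right hin,
        hlim (graphNormal ψ L y)] with t h1 h2 h3
      have h4 := (h _ h2).1.1 h3
      have h5 : 0 < graphFun Q₀ ψ L (Q + t • graphNormal ψ L y) := sub_pos.2 h4
      simp only [Pi.neg_apply, zero_smul, add_zero, hgQ, zero_add] at h1
      linarith

/-- The choice made in `nu` is harmless, since exactly one vector satisfies the defining condition.
-/
theorem IsGraphChart.nu_eq {Ω : Set Space} {r : ℝ}
    (h : IsGraphChart Ω Q₀ r ψ L) (hψ : Differentiable ℝ ψ) {Q : Space}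
    (hQ : Q ∈ frontier Ω) (hQr : Q ∈ Metric.ball Q₀ r) :
    nu Ω Q = graphNormal ψ L (horiz (L (Q - Q₀))) :=
  (h.isOutwardUnitNormal_iff hψ hQ hQr _).1
    (Classical.epsilon_spec ⟨_, (h.isOutwardUnitNormal_iff hψ hQ hQr _).2 rfl⟩)

end Graph

theorem IsC2Domain.exists_chart {Ω : Set Space} (hΩ : IsC2Domain Ω) {Q : Space}
    (hQ : Q ∈ frontier Ω) : ∃ r > 0, ∃ ψ : Plane → ℝ, ContDiff ℝ 2 ψ ∧
      ∃ L : Space ≃ₗᵢ[ℝ] Space, IsGraphChart Ω Q r ψ L :=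
  hΩ.2 Q hQ

theorem continuousOn_nu {Ω : Set Space} (hΩ : IsC2Domain Ω) :
    ContinuousOn (nu Ω) (frontier Ω) := by
  intro Q hQ
  obtain ⟨r, hr, ψ, hψ, L, h⟩ := hΩ.exists_chart hQ
  have hc : Continuous fun x : Space => graphNormal ψ L (horiz (L (x - Q))) :=
    (differentiable_graphNormal hψ).continuous.comp (by fun_prop)
  refine hc.continuousWithinAt.congr_of_eventuallyEq_of_mem ?_ hQ
  filter_upwards [self_mem_nhdsWithin, mem_nhdsWithin_of_mem_nhds (Metric.ball_mem_nhds Q hr)]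
    with x hx hxr using h.nu_eq (hψ.differentiable (by norm_num)) hx hxr

/-! ### Measurability in the tubular neighbourhood -/

theorem continuousOn_tubularMap {Ω : Set Space} (hΩ : IsC2Domain Ω) (I : Set ℝ) :
    ContinuousOn (tubularMap Ω) (frontier Ω ×ˢ I) := by
  have h1 : ContinuousOn (fun p : Space × ℝ => nu Ω p.1) (frontier Ω ×ˢ I) :=
    (continuousOn_nu hΩ).comp continuousOn_fst fun p hp => hp.1
  unfold tubularMap
  fun_prop

theorem volume_preimage_apply_eq_zero {N : Set ℝ} (hN : volume N = 0) (i : Fin 3) :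
    volume {z : Space | z i ∈ N} = 0 := by
  have h1 : Measure.QuasiMeasurePreserving (fun f : Fin 3 → ℝ => f i) volume volume :=
    Measure.quasiMeasurePreserving_eval _ i
  have h2 := h1.comp (PiLp.volume_preserving_ofLp (Fin 3)).quasiMeasurePreserving
  exact h2.preimage_null hN

/-- In a chart the map is `z ↦ graphPt (z₁, z₂) + z₃ graphNormal (z₁, z₂)`. It is differentiable
because `ψ` is `C²` and the normal involves one derivative of `ψ`; no control of the Jacobian is
needed to preserve null sets. Countably many charts cover the boundary. -/
theorem volume_image_tubularMap_eq_zero {Ω : Set Space} (hΩ : IsC2Domain Ω) {N : Set ℝ}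
    (hN : volume N = 0) : volume (tubularMap Ω '' (frontier Ω ×ˢ N)) = 0 := by
  have hloc : ∀ Q ∈ frontier Ω, ∃ r > 0,
      volume (tubularMap Ω '' ((frontier Ω ∩ Metric.ball Q r) ×ˢ N)) = 0 := by
    intro Q hQ
    obtain ⟨r, hr, ψ, hψ, L, h⟩ := hΩ.exists_chart hQ
    have hψ1 : Differentiable ℝ ψ := hψ.differentiable (by norm_num)
    have hP : Differentiable ℝ (graphPt Q ψ L) := fun y =>
      (hasFDerivAt_graphPt hψ1 y).differentiableAt
    have hn := differentiable_graphNormal (L := L) hψ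
    refine ⟨r, hr, measure_mono_null ?_ (addHaar_image_eq_zero_of_differentiableOn_of_addHaar_eq_zero
      volume (f := fun z : Space => graphPt Q ψ L (horiz z) + z 2 • graphNormal ψ L (horiz z))
      (s := {z | z 2 ∈ N}) ?_ (volume_preimage_apply_eq_zero hN 2))⟩
    · rintro _ ⟨⟨x, t⟩, ⟨⟨hx, hxr⟩, ht⟩, rfl⟩
      refine ⟨planeIncl (horiz (L (x - Q))) + t • basisVec 2, ?_, ?_⟩
      · rw [mem_ofPred_eq, planeIncl_add_apply_two]; exact ht
      · simp only [horiz_planeIncl_add, planeIncl_add_apply_two]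
        rw [graphPt_eq ((h x hxr).2.1 hx), tubularMap, h.nu_eq hψ1 hx hxr]
    · exact (Differentiable.add (hP.comp horiz.differentiable)
        (Differentiable.smul (EuclideanSpace.proj (𝕜 := ℝ) (2 : Fin 3)).differentiable
          (hn.comp horiz.differentiable))).differentiableOn
  choose! r hr hr0 using hloc
  obtain ⟨T, hT, hTc, hcov⟩ := TopologicalSpace.countable_cover_nhdsWithin
    (f := fun Q => Metric.ball Q (r Q)) fun Q hQ =>
      mem_nhdsWithin_of_mem_nhds (Metric.ball_mem_nhds Q (hr Q hQ))
  refine measure_mono_null ?_ ((measure_biUnion_null_iff hTc).2 fun Q hQ => hr0 Q (hT hQ))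
  rintro _ ⟨⟨x, t⟩, ⟨hx, ht⟩, rfl⟩
  obtain ⟨Q, hQ, hxQ⟩ := mem_iUnion₂.1 (hcov hx)
  exact mem_iUnion₂.2 ⟨Q, hQ, mem_image_of_mem _ ⟨⟨hx, hxQ⟩, ht⟩⟩

/-- The `t`-coordinate in the tubular neighbourhood of width `ε`. -/
def tubularHeight (Ω : Set Space) (ε : ℝ) (x : Space) : ℝ :=
  (Function.invFunOn (tubularMap Ω) (frontier Ω ×ˢ Ioo (-ε) ε) x).2

theorem image_tubularMap_eq {Ω : Set Space} {ε : ℝ}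
    (h : BijOn (tubularMap Ω) (frontier Ω ×ˢ Ioo (-ε) ε) (layer Ω ε)) (B : Set ℝ) :
    tubularMap Ω '' (frontier Ω ×ˢ (Ioo (-ε) ε ∩ B)) = tubularHeight Ω ε ⁻¹' B ∩ layer Ω ε := by
  ext x
  constructor
  · rintro ⟨⟨Q, t⟩, ⟨hQ, ht, htB⟩, rfl⟩
    have hm : (Q, t) ∈ frontier Ω ×ˢ Ioo (-ε) ε := ⟨hQ, ht⟩
    refine ⟨?_, h.mapsTo hm⟩
    rw [mem_preimage, tubularHeight, h.injOn.leftInvOn_invFunOn hm]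
    exact htB
  · rintro ⟨hB, hx⟩
    have h1 := h.surjOn.mapsTo_invFunOn hx
    exact ⟨_, ⟨h1.1, h1.2, hB⟩, h.surjOn.rightInvOn_invFunOn hx⟩

/-- The points of the layer with height in a Borel set are the image of a Borel set under an
injective continuous map, hence Borel by the Lusin–Souslin theorem. -/
theorem measurable_indicator_tubularHeight {Ω : Set Space} (hΩ : IsC2Domain Ω) {ε : ℝ}
    (h : BijOn (tubularMap Ω) (frontier Ω ×ˢ Ioo (-ε) ε) (layer Ω ε)) {g : ℝ → ℝ}
    (hg : Measurable g) :
    Measurable ((layer Ω ε).indicator fun x => g (tubularHeight Ω ε x)) := by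
  have hL : MeasurableSet (layer Ω ε) := Metric.isOpen_thickening.measurableSet
  intro B hB
  rw [indicator_preimage]
  have h1 : MeasurableSet ((fun x => g (tubularHeight Ω ε x)) ⁻¹' B ∩ layer Ω ε) := by
    have e : (fun x => g (tubularHeight Ω ε x)) ⁻¹' B = tubularHeight Ω ε ⁻¹' (g ⁻¹' B) := rfl
    rw [e, ← image_tubularMap_eq h]
    exact (isClosed_frontier.measurableSet.prod
      (measurableSet_Ioo.inter (hg hB))).image_of_continuousOn_injOn
      (continuousOn_tubularMap hΩ _)
      (h.injOn.mono (prod_mono_right inter_subset_left))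
  exact h1.union ((measurable_const hB).diff hL)

theorem _root_.MeasureTheory.MemLp.exists_ae_norm_le {α E : Type*} [MeasurableSpace α]
    [NormedAddCommGroup E] {μ : Measure α} {w : α → E} (hw : MemLp w ⊤ μ) :
    ∃ C : ℝ, ∀ᵐ x ∂μ, ‖w x‖ ≤ C := by
  refine ⟨(eLpNorm w ⊤ μ).toReal, ?_⟩
  have h := hw.2
  rw [eLpNorm_exponent_top] at h ⊢
  filter_upwards [enorm_ae_le_eLpNormEssSup w μ] with x hx
  rw [← toReal_enorm]
  exact ENNReal.toReal_mono h.ne hx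

/-- A Borel representative of `V` may replace `V`: the heights where they differ, or where the
essential bound fails, form a null set, and the tubular map carries it to a null set of the layer.
-/
theorem memLp_bigV {Ω : Set Space} (hΩ : IsC2Domain Ω)
    {η : ℝ} (hη : IsTubularRadius Ω η) {V : ℝ → ℝ} (hV : MemLp V ⊤ (volume : Measure ℝ))
    {ε : ℝ} (hε : 0 < ε) (hεη : ε ≤ η) : MemLp (bigV Ω V η ε) ⊤ (volume : Measure Space) := by
  have h := hη.2 ε hε hεη
  have hη0 := hη.1
  obtain ⟨C, hC⟩ := hV.exists_ae_norm_le
  obtain ⟨V', hV'm, hVV'⟩ := hV.1.aemeasurable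
  set g : ℝ → ℝ := fun t => η / ε * V' (η * t / ε) with hg
  have hgm : Measurable g := by fun_prop
  have hq : Measure.QuasiMeasurePreserving (fun t : ℝ => η * t / ε) volume volume := by
    have h1 := Measure.quasiMeasurePreserving_smul (μ := (volume : Measure ℝ))
      (r := η / ε) (by positivity)
    refine (funext fun t => ?_ : (fun t : ℝ => η * t / ε) = fun t => (η / ε) • t) ▸ h1
    rw [smul_eq_mul]; ring
  have hN : ∀ᵐ t : ℝ, scaledV V η ε t = g t ∧ ‖g t‖ ≤ η / ε * C := by
    filter_upwards [hq.ae hVV', hq.ae hC] with t h1 h2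
    have e : scaledV V η ε t = g t := by rw [scaledV, h1]
    refine ⟨e, ?_⟩
    rw [← e, scaledV, norm_mul, Real.norm_of_nonneg (by positivity)]
    gcongr
  have hae : ∀ᵐ x : Space, x ∈ layer Ω ε → scaledV V η ε (tubularHeight Ω ε x) =
      g (tubularHeight Ω ε x) ∧ ‖g (tubularHeight Ω ε x)‖ ≤ η / ε * C := by
    refine measure_mono_null ?_ (volume_image_tubularMap_eq_zero hΩ
      (measure_mono_null (inter_subset_right (s := Ioo (-ε) ε)) hN))
    rw [image_tubularMap_eq h]
    intro x hx
    simp only [mem_compl_iff, mem_ofPred_eq, Classical.not_imp] at hx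
    exact ⟨hx.2, hx.1⟩
  have e : bigV Ω V η ε =ᵐ[volume] (layer Ω ε).indicator fun x => g (tubularHeight Ω ε x) := by
    filter_upwards [hae] with x hx
    by_cases hxl : x ∈ layer Ω ε
    · rw [bigV, if_pos hxl, indicator_of_mem hxl]; exact (hx hxl).1
    · rw [bigV, if_neg hxl, indicator_of_notMem hxl]
  refine (memLp_congr_ae e).2 (memLp_top_of_bound
    (measurable_indicator_tubularHeight hΩ h hgm).aestronglyMeasurable (η / ε * |C|) ?_)
  filter_upwards [hae] with x hx
  by_cases hxl : x ∈ layer Ω ε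
  · rw [indicator_of_mem hxl]
    exact (hx hxl).2.trans (by gcongr; exact le_abs_self C)
  · rw [indicator_of_notMem hxl, norm_zero]; positivity

/-! ### The coupled operators -/

theorem memLp_top_comp {α : Type*} [MeasurableSpace α] {μ : Measure α} {w : α → ℝ}
    (hw : MemLp w ⊤ μ) {F : ℝ → ℝ} (hF : Measurable F) (hFw : ∀ t, |F t| ≤ 1 + |t|) :
    MemLp (fun x => F (w x)) ⊤ μ := by
  obtain ⟨C, hC⟩ := hw.exists_ae_norm_le
  refine memLp_top_of_bound (hF.comp_aemeasurable hw.1.aemeasurable).aestronglyMeasurable (1 + C) ?_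
  filter_upwards [hC] with x hx
  exact (hFw _).trans (by simpa using hx)

theorem measurable_sign : Measurable Real.sign := by
  unfold Real.sign
  refine Measurable.ite measurableSet_Iio measurable_const
    (Measurable.ite measurableSet_Ioi measurable_const measurable_const)

theorem sqrt_abs_le (t : ℝ) : √|t| ≤ 1 + |t| := by
  rw [Real.sqrt_le_left (by positivity)]
  nlinarith [abs_nonneg t]

theorem memLp_bigU {Ω : Set Space} {V : ℝ → ℝ} {η ε : ℝ}
    (h : MemLp (bigV Ω V η ε) ⊤ (volume : Measure Space)) :
    MemLp (bigU Ω V η ε) ⊤ (volume : Measure Space) := by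
  refine memLp_top_comp h (F := fun t => √|t|) (by fun_prop) fun t => ?_
  rw [abs_of_nonneg (Real.sqrt_nonneg _)]
  exact sqrt_abs_le t

theorem memLp_smallV {Ω : Set Space} {V : ℝ → ℝ} {η ε : ℝ}
    (h : MemLp (bigV Ω V η ε) ⊤ (volume : Measure Space)) :
    MemLp (smallV Ω V η ε) ⊤ (volume : Measure Space) := by
  refine memLp_top_comp h (F := fun t => Real.sign t * √|t|)
    (measurable_sign.mul (by fun_prop)) fun t => ?_
  rw [abs_mul, abs_of_nonneg (Real.sqrt_nonneg _)]
  refine le_trans ?_ (sqrt_abs_le t)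
  refine mul_le_of_le_one_left (Real.sqrt_nonneg _) ?_
  rcases Real.sign_apply_eq t with h | h | h <;> simp [h]

theorem smallV_mul_bigU (Ω : Set Space) (V : ℝ → ℝ) (η ε : ℝ) (x : Space) :
    smallV Ω V η ε x * bigU Ω V η ε x = bigV Ω V η ε x := by
  rw [smallV, bigU, mul_assoc, Real.mul_self_sqrt (abs_nonneg _)]
  rcases lt_trichotomy (bigV Ω V η ε x) 0 with h | h | h
  · rw [Real.sign_of_neg h, abs_of_neg h]; ring
  · simp [h]
  · rw [Real.sign_of_pos h, abs_of_pos h, one_mul]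

theorem mulOp_bigV {Ω : Set Space} {V : ℝ → ℝ} {η ε : ℝ}
    (h : MemLp (bigV Ω V η ε) ⊤ (volume : Measure Space)) :
    mulOp (bigV Ω V η ε) = mulOp (smallV Ω V η ε) ∘L mulOp (bigU Ω V η ε) := by
  have e : (fun x => smallV Ω V η ε x * bigU Ω V η ε x) = bigV Ω V η ε :=
    funext (smallV_mul_bigU Ω V η ε)
  rw [← mulOp_mul (memLp_smallV h) (memLp_bigU h) (by rw [e]; exact h), e]

theorem isUnit_matOp_beta : IsUnit (matOp beta) :=
  ⟨⟨matOp beta, matOp beta, matOp_beta_mul_matOp_beta, matOp_beta_mul_matOp_beta⟩, rfl⟩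

theorem matOp_beta_add (K : L2 →L[ℂ] L2) :
    matOp beta + K = matOp beta * (1 + matOp beta ∘L K) := by
  change _ = matOp beta * (1 + matOp beta * K)
  rw [mul_add, mul_one, ← mul_assoc, matOp_beta_mul_matOp_beta, one_mul]

/-- Because `β² = 1`, inverting `β + K = β (1 + β K)` gives `(1 + β K)⁻¹ β`. The trailing `β` is the
one in `β 𝐮_ε`, so the abstract resolvent formula takes the form with `β + 𝐮_ε Φ^a 𝐯_ε`. -/
theorem inverse_matOp_beta_add {K : L2 →L[ℂ] L2} (hK : IsUnit (1 + matOp beta ∘L K)) :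
    Ring.inverse (matOp beta + K) = Ring.inverse (1 + matOp beta ∘L K) ∘L matOp beta := by
  obtain ⟨U, hU⟩ := hK
  let B : (L2 →L[ℂ] L2)ˣ :=
    ⟨matOp beta, matOp beta, matOp_beta_mul_matOp_beta, matOp_beta_mul_matOp_beta⟩
  have e : matOp beta + K = ((B * U : (L2 →L[ℂ] L2)ˣ) : L2 →L[ℂ] L2) := by
    rw [matOp_beta_add, ← hU]; rfl
  rw [e, ← hU, Ring.inverse_unit, Ring.inverse_unit, mul_inv_rev]
  rfl

theorem scalarDirac_eq {Ω : Set Space} {V : ℝ → ℝ} {η ε : ℝ} (m : ℝ)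
    (h : MemLp (bigV Ω V η ε) ⊤ (volume : Measure Space)) :
    scalarDirac m Ω V η ε = perturbedDirac m (mulOp (smallV Ω V η ε) ∘L
      (matOp beta ∘L mulOp (bigU Ω V η ε))) := by
  rw [scalarDirac, mulOp_bigV h, ← ContinuousLinearMap.comp_assoc, ← ContinuousLinearMap.comp_assoc,
    matOp_comp_mulOp (memLp_smallV h)]

end DiracShell

end

/-! ### The electrostatic and Lorentz scalar couplings. -/

open MeasureTheory Set DiracShell in
theorem proposition2p5 (m : ℝ) (hm : 0 < m)
    (Ω : Set Space) (hΩ : IsC2Domain Ω) (hΩb : Bornology.IsBounded Ω)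
    (η : ℝ) (hη : IsTubularRadius Ω η)
    (V : ℝ → ℝ) (hV : MemLp V ⊤ (volume : Measure ℝ))
    (hVsupp : ∀ᵐ t : ℝ, t ∉ Icc (-η) η → V t = 0)
    (ε : ℝ) (hε : 0 < ε) (hεη : ε ≤ η)
    (a : ℂ) (ha : a.im ≠ 0 ∨ (a.im = 0 ∧ -m < a.re ∧ a.re < m)) :
    -- the operators in the statement are well defined
    (MemLp (bigV Ω V η ε) ⊤ (volume : Measure Space) ∧
      MemLp (bigU Ω V η ε) ⊤ (volume : Measure Space) ∧
      MemLp (smallV Ω V η ε) ⊤ (volume : Measure Space) ∧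
      IsConvolutionOp (phi m a) (Phi m a)) ∧
    -- electrostatic case
    ((a ∈ resolventSetOf (electricDirac m Ω V η ε) ↔
        -1 ∈ resolventSet ℂ (birmanSchwinger m Ω V η ε a)) ∧
      (a ∈ pointSpectrumOf (electricDirac m Ω V η ε) ↔
        Module.End.HasEigenvalue (birmanSchwinger m Ω V η ε a : L2 →ₗ[ℂ] L2) (-1)) ∧
      Module.rank ℂ (eigenspaceOf (electricDirac m Ω V η ε) a) =
        Module.rank ℂ
          (Module.End.eigenspace (birmanSchwinger m Ω V η ε a : L2 →ₗ[ℂ] L2) (-1)) ∧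
      (a ∈ resolventSetOf (electricDirac m Ω V η ε) →
        IsUnit (1 + birmanSchwinger m Ω V η ε a) ∧
        resolventOf (electricDirac m Ω V η ε) a =
          Phi m a - Phi m a ∘L mulOp (smallV Ω V η ε) ∘L
            Ring.inverse (1 + birmanSchwinger m Ω V η ε a) ∘L
            mulOp (bigU Ω V η ε) ∘L Phi m a)) ∧
    -- Lorentz scalar case
    ((a ∈ resolventSetOf (scalarDirac m Ω V η ε) ↔
        -1 ∈ resolventSet ℂ (matOp beta ∘L birmanSchwinger m Ω V η ε a)) ∧
      (a ∈ pointSpectrumOf (scalarDirac m Ω V η ε) ↔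
        Module.End.HasEigenvalue
          (matOp beta ∘L birmanSchwinger m Ω V η ε a : L2 →ₗ[ℂ] L2) (-1)) ∧
      Module.rank ℂ (eigenspaceOf (scalarDirac m Ω V η ε) a) =
        Module.rank ℂ (Module.End.eigenspace
          (matOp beta ∘L birmanSchwinger m Ω V η ε a : L2 →ₗ[ℂ] L2) (-1)) ∧
      (a ∈ resolventSetOf (scalarDirac m Ω V η ε) →
        IsUnit (matOp beta + birmanSchwinger m Ω V η ε a) ∧
        resolventOf (scalarDirac m Ω V η ε) a =
          Phi m a - Phi m a ∘L mulOp (smallV Ω V η ε) ∘L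
            Ring.inverse (matOp beta + birmanSchwinger m Ω V η ε a) ∘L
            mulOp (bigU Ω V η ε) ∘L Phi m a)) := by
  have hV' := memLp_bigV hΩ hη hV hε hεη
  have hz := sq_sub_sq_mem_slitPlane ha
  have hΦ := isResolventAt_Phi hz
  have hs := scalarDirac_eq m hV'
  have hB : matOp beta ∘L birmanSchwinger m Ω V η ε a =
    (matOp beta ∘L mulOp (bigU Ω V η ε)) ∘L Phi m a ∘L mulOp (smallV Ω V η ε) := rfl
  refine ⟨⟨hV', memLp_bigU hV', memLp_smallV hV', isConvolutionOp_Phi hz⟩,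
    ⟨?_, ?_, ?_, fun h => ?_⟩, ⟨?_, ?_, ?_, fun h => ?_⟩⟩
  · rw [electricDirac, mulOp_bigV hV']
    exact hΦ.mem_resolventSetOf_perturbed_iff
  · rw [electricDirac, mulOp_bigV hV']
    exact hΦ.mem_pointSpectrumOf_perturbed_iff
  · rw [electricDirac, mulOp_bigV hV']
    exact hΦ.eigenspaceEquiv.rank_eq
  · rw [electricDirac, mulOp_bigV hV'] at h ⊢
    exact hΦ.resolventOf_perturbed h
  · rw [hs]
    exact hΦ.mem_resolventSetOf_perturbed_iff
  · rw [hs]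
    exact hΦ.mem_pointSpectrumOf_perturbed_iff
  · rw [hs]
    exact hΦ.eigenspaceEquiv.rank_eq
  · rw [hs] at h ⊢
    obtain ⟨h1, h2⟩ := hΦ.resolventOf_perturbed h
    rw [← hB] at h1 h2
    refine ⟨matOp_beta_add (birmanSchwinger m Ω V η ε a) ▸ isUnit_matOp_beta.mul h1, ?_⟩
    rw [h2, inverse_matOp_beta_add h1]
    rfl
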